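/- Let $\beta>0$ and $\gamma\ge 1$. For $n\ge1$ put $2\alpha=\beta\gamma(n-1)$ and let $L_\beta^{(n)}$ be the random symmetric tridiagonal $n\times n$ matrix with diagonal entries $a_0,\dots,a_{n-1}$ and off-diagonal entries $b_1,\dots,b_{n-1}$ ($b_j$ standing between $a_{j-1}$ and $a_j$), where $$a_0\sim\tfrac1n\chi^2_{2\alpha},\qquad a_j\sim\tfrac1n\chi^2_{2\alpha+\beta(n-2j)},\qquad b_j\sim\tfrac1n\,\chi_{2\alpha-\beta(j-1)}\,\chi_{\beta(n-j)}\qquad(1\le j\le n-1),$$ the two factors in $b_j$ being independent $\chi$ variables ($\chi^2_0=0$). All matrices are defined on one probability space, and the dependence between different entries is arbitrary. Regard $L_\beta^{(n)}$ as the path on $n$ vertices whose loop at the $j$-th vertex has weight $a_j$ ($0\le j\le n-1$) and whose edge between the vertices $j-1$ and $j$ has weight $b_j$, and choose a root uniformly among the $n$ vertices, independently of the matrix. Let $L$ be the random rooted weighted graph obtained by drawing $u\sim\mathrm{Unif}[0,1]$ and taking the graph $\mathbb Z$ (edges between consecutive integers, a loop at every integer) rooted at $0$, with all loop weights equal to $\beta(\gamma+1-2u)$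 and all edge weights equal to $\beta\sqrt{(\gamma-u)(1-u)}$. Then, as $n\to\infty$, the randomly rooted weighted graphs of $L_\beta^{(n)}$ converge to $L$ in the Benjamini–Schramm sense, i.e. their laws converge weakly on the space of isomorphism classes of rooted connected locally finite weighted graphs with the local topology (two graphs are close if balls of large radius around the roots are isomorphic with nearly equal weights). This holds both for almost every realization of the matrices (only the root being random) and when the matrix and the root are both random. Moreover the expected spectral measure of the limit, $\mu_L(X)=\mathbb E\,\langle P_X\chi_0,\chi_0\rangle$, where $P$ is the projection-valued spectral measure of the adjacency operator $(Af)(v)=\beta\sqrt{(\gamma-u)(1-u)}\,[f(v-1)+f(v+1)]+\beta(\gamma+1-2u)f(v)$ on $\ell^2(\mathbb Z)$ and $\chi_0$ is the indicator function of the root, is the Marchenko–Pastur law $$\mu_L(dx)=\mathbf 1[x\in[L_-,L_+]]\,\frac{\sqrt{(x-L_-)(L_+-x)}}{2\pi\beta x}\,dx,\qquad L_\pm=\beta(1\pm\sqrt\gamma)^2 .$$ -/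

import Mathlib

open MeasureTheory ProbabilityTheory Filter Topology

/-- A rooted, connected, locally finite graph with real symmetric weights on its edges and loops.
Every vertex `v` carries a loop of weight `weight v v`. -/
structure RootedWeightedGraph where
  V : Type
  graph : SimpleGraph V
  connected : graph.Connected
  locallyFinite : ∀ v, (graph.neighborSet v).Finite
  weight : V → V → ℝ
  weight_symm : ∀ u v, weight u v = weight v u
  weight_eq_zero : ∀ u v, u ≠ v → ¬ graph.Adj u v → weight u v = 0
  root : V

namespace RootedWeightedGraph

/-- Vertices of the ball `B_r(G, o)` of radius `r` around the root. -/
def ball (G : RootedWeightedGraph) (r : ℕ) : Set G.V := {v | G.graph.dist G.root v ≤ r}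

theorem root_mem_ball (G : RootedWeightedGraph) (r : ℕ) : G.root ∈ G.ball r := by
  simp [ball]

/-- Isomorphism of rooted weighted graphs. -/
def IsIso (G H : RootedWeightedGraph) : Prop :=
  ∃ φ : G.graph ≃g H.graph, φ G.root = H.root ∧ ∀ u v, H.weight (φ u) (φ v) = G.weight u v

instance isoSetoid : Setoid RootedWeightedGraph where
  r := IsIso
  iseqv :=
    { refl := fun G => ⟨SimpleGraph.Iso.refl, rfl, fun _ _ => rfl⟩
      symm := by
        rintro G H ⟨φ, h, hw⟩
        refine ⟨φ.symm, by rw [← h]; simp, fun u v => ?_⟩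
        rw [← hw]; simp
      trans := by
        rintro G H K ⟨φ, h, hw⟩ ⟨ψ, h', hw'⟩
        refine ⟨φ.trans ψ, ?_, fun u v => ?_⟩
        · change ψ (φ G.root) = K.root
          rw [h, h']
        · change K.weight (ψ (φ u)) (ψ (φ v)) = G.weight u v
          rw [hw', hw] }

/-- The balls of radius `r` around the roots of `G` and `H` are isomorphic as rooted graphs, by an
isomorphism under which the weights of edges and loops differ by less than `ε`. -/
def LocallyClose (r : ℕ) (ε : ℝ) (G H : RootedWeightedGraph) : Prop :=
  ∃ φ : G.graph.induce (G.ball r) ≃g H.graph.induce (H.ball r),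
    (φ ⟨G.root, G.root_mem_ball r⟩ : H.V) = H.root ∧
      ∀ u v : G.ball r, |H.weight (φ u) (φ v) - G.weight u v| < ε

theorem dist_iso_ball_le {G H : RootedWeightedGraph} {r : ℕ}
    (φ : G.graph.induce (G.ball r) ≃g H.graph.induce (H.ball r))
    (hφ : (φ ⟨G.root, G.root_mem_ball r⟩ : H.V) = H.root) (k : ℕ) (v : G.ball r)
    (hv : G.graph.dist G.root v = k) : H.graph.dist H.root (φ v) ≤ k := by
  induction k generalizing v with
  | zero =>
    have h0 : G.root = v := (G.connected.dist_eq_zero_iff).1 hv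
    have h1 : v = ⟨G.root, G.root_mem_ball r⟩ := Subtype.ext h0.symm
    rw [h1, hφ]
    simp
  | succ k ih =>
    obtain ⟨w, hadj, hw⟩ : ∃ w, G.graph.Adj v w ∧ G.graph.dist G.root w ≤ k := by
      obtain ⟨v, hvr⟩ := v
      change G.graph.dist G.root v = k + 1 at hv
      change ∃ w, G.graph.Adj v w ∧ G.graph.dist G.root w ≤ k
      obtain ⟨p, hp⟩ := G.connected.exists_walk_length_eq_dist v G.root
      rw [SimpleGraph.dist_comm, hv] at hp
      cases p with
      | nil => simp at hp
      | cons hadj q =>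
        simp only [SimpleGraph.Walk.length_cons, Nat.add_right_cancel_iff] at hp
        refine ⟨_, hadj, ?_⟩
        rw [SimpleGraph.dist_comm, ← hp]
        exact SimpleGraph.dist_le q
    have hvw : G.graph.dist G.root v ≤ G.graph.dist G.root w + 1 := by
      have h1 := G.connected.dist_triangle (u := G.root) (v := w) (w := v)
      rwa [SimpleGraph.dist_eq_one_iff_adj.2 hadj.symm] at h1
    have hwk : G.graph.dist G.root w = k := by omega
    have hwr : w ∈ G.ball r := by
      have h1 : G.graph.dist G.root v ≤ r := v.2
      change G.graph.dist G.root w ≤ r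
      omega
    have h2 := ih ⟨w, hwr⟩ hwk
    have h3 : (G.graph.induce (G.ball r)).Adj ⟨w, hwr⟩ v := hadj.symm
    have h4 : H.graph.Adj (φ ⟨w, hwr⟩) (φ v) := φ.map_rel_iff.2 h3
    have h5 := H.connected.dist_triangle (u := H.root) (v := (φ ⟨w, hwr⟩ : H.V))
      (w := (φ v : H.V))
    rw [SimpleGraph.dist_eq_one_iff_adj.2 h4] at h5
    omega

theorem LocallyClose.mono {G H : RootedWeightedGraph} {r s : ℕ} {ε δ : ℝ} (hsr : s ≤ r)
    (hδ : δ ≤ ε) (h : LocallyClose r δ G H) : LocallyClose s ε G H := by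
  obtain ⟨φ, hφ, hw⟩ := h
  have hφ' : (φ.symm ⟨H.root, H.root_mem_ball r⟩ : G.V) = G.root := by
    have : (⟨H.root, H.root_mem_ball r⟩ : H.ball r) = φ ⟨G.root, G.root_mem_ball r⟩ :=
      Subtype.ext hφ.symm
    rw [this]
    simp
  have hG : ∀ v, v ∈ G.ball s → v ∈ G.ball r := fun v hv => le_trans hv hsr
  have hH : ∀ v, v ∈ H.ball s → v ∈ H.ball r := fun v hv => le_trans hv hsr
  let e : G.ball s ≃ H.ball s :=
    { toFun := fun v => ⟨φ ⟨v, hG v v.2⟩, (dist_iso_ball_le φ hφ _ _ rfl).trans v.2⟩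
      invFun := fun v => ⟨φ.symm ⟨v, hH v v.2⟩, (dist_iso_ball_le φ.symm hφ' _ _ rfl).trans v.2⟩
      left_inv := fun v => by simp
      right_inv := fun v => by simp }
  refine ⟨⟨e, ?_⟩, hφ, fun u v => lt_of_lt_of_le (hw ⟨u, hG u u.2⟩ ⟨v, hG v v.2⟩) hδ⟩
  intro u v
  exact φ.map_rel_iff (a := ⟨u, hG u u.2⟩) (b := ⟨v, hG v v.2⟩)

/-- The local topology: the sets `{H | LocallyClose r ε G H}` form neighbourhood bases. -/
instance localTopology : TopologicalSpace RootedWeightedGraph where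
  IsOpen U := ∀ G ∈ U, ∃ r : ℕ, ∃ ε : ℝ, 0 < ε ∧ ∀ H, LocallyClose r ε G H → H ∈ U
  isOpen_univ := fun _ _ => ⟨0, 1, one_pos, fun _ _ => trivial⟩
  isOpen_inter := by
    rintro U W hU hW G ⟨hGU, hGW⟩
    obtain ⟨r, ε, hε, h⟩ := hU G hGU
    obtain ⟨s, δ, hδ, h'⟩ := hW G hGW
    refine ⟨max r s, min ε δ, lt_min hε hδ, fun H hH => ⟨h H ?_, h' H ?_⟩⟩
    · exact hH.mono (le_max_left _ _) (min_le_left _ _)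
    · exact hH.mono (le_max_right _ _) (min_le_right _ _)
  isOpen_sUnion := by
    rintro S hS G ⟨U, hU, hGU⟩
    obtain ⟨r, ε, hε, h⟩ := hS U hU G hGU
    exact ⟨r, ε, hε, fun H hH => ⟨U, hU, h H hH⟩⟩

end RootedWeightedGraph

/-- The space of isomorphism classes of rooted, connected, locally finite weighted graphs, with the
(quotient of the) local topology and its Borel σ-algebra. -/
def RootedGraphClass := Quotient RootedWeightedGraph.isoSetoid

namespace RootedGraphClass

instance : TopologicalSpace RootedGraphClass :=
  inferInstanceAs (TopologicalSpace (Quotient RootedWeightedGraph.isoSetoid))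

instance : MeasurableSpace RootedGraphClass := borel _

instance : BorelSpace RootedGraphClass := ⟨rfl⟩

/-- The isomorphism class of a rooted weighted graph. -/
def mk (G : RootedWeightedGraph) : RootedGraphClass := Quotient.mk _ G

end RootedGraphClass

/-- Benjamini–Schramm (local weak) convergence of random rooted weighted graphs `X n`, defined on
probability spaces `(Ω n, P n)`, to the random rooted graph `Y` on `(Ω', P')`: the laws of the
isomorphism classes converge weakly with respect to the local topology. -/
def BenjaminiSchrammConverges {Ω : ℕ → Type*} [∀ n, MeasurableSpace (Ω n)] {Ω' : Type*}
    [MeasurableSpace Ω'] (P : (n : ℕ) → Measure (Ω n)) [∀ n, IsProbabilityMeasure (P n)]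
    (X : (n : ℕ) → Ω n → RootedWeightedGraph) (P' : Measure Ω') [IsProbabilityMeasure P']
    (Y : Ω' → RootedWeightedGraph) : Prop :=
  TendstoInDistribution (fun n ω => RootedGraphClass.mk (X n ω)) atTop
    (fun ω => RootedGraphClass.mk (Y ω)) P P'

/-- `A` is the adjacency operator of `G` on `ℓ²(V)`. (The sum is finite, as `G` is locally
finite.) -/
def IsAdjacencyOperator (G : RootedWeightedGraph)
    (A : lp (fun _ : G.V => ℂ) 2 →L[ℂ] lp (fun _ : G.V => ℂ) 2) : Prop :=
  ∀ (f : lp (fun _ : G.V => ℂ) 2) (v : G.V), A f v = ∑ᶠ u, (G.weight v u : ℂ) * f u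

/-- `P` is the projection-valued measure (resolution of the identity) on the Borel sets of `ℝ` of
the bounded self-adjoint operator `A`, i.e. `A = ∫ x dP(x)`. -/
structure IsSpectralResolution {E : Type*} [NormedAddCommGroup E] [InnerProductSpace ℂ E]
    [CompleteSpace E] (A : E →L[ℂ] E) (P : Set ℝ → E →L[ℂ] E) : Prop where
  isStarProjection : ∀ X, MeasurableSet X → IsStarProjection (P X)
  univ : P Set.univ = 1
  inter : ∀ X Y, MeasurableSet X → MeasurableSet Y → P (X ∩ Y) = P X * P Y
  iUnion : ∀ X : ℕ → Set ℝ, (∀ i, MeasurableSet (X i)) → Pairwise (Function.onFun Disjoint X) →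
    ∀ f, HasSum (fun i => P (X i) f) (P (⋃ i, X i) f)
  integral : ∀ f, ∃ μ : Measure ℝ,
    (∀ X, MeasurableSet X → μ X = ENNReal.ofReal (inner ℂ (P X f) f).re) ∧
      Integrable (fun x => x) μ ∧ ((∫ x, x ∂μ : ℝ) : ℂ) = inner ℂ (A f) f

open Classical in
/-- `μ` is the spectral measure of the adjacency operator of `G` with respect to the root `o`:
`μ(X) = ⟨P_X χ_o, χ_o⟩`, where `P` is the projection-valued measure of the adjacency operator. -/
def IsRootSpectralMeasure (G : RootedWeightedGraph) (μ : Measure ℝ) : Prop :=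
  ∃ (A : lp (fun _ : G.V => ℂ) 2 →L[ℂ] lp (fun _ : G.V => ℂ) 2)
    (P : Set ℝ → lp (fun _ : G.V => ℂ) 2 →L[ℂ] lp (fun _ : G.V => ℂ) 2),
    IsAdjacencyOperator G A ∧ IsSpectralResolution A P ∧
      ∀ X, MeasurableSet X →
        μ X = ENNReal.ofReal
          (inner ℂ (P X (lp.single 2 G.root (1 : ℂ))) (lp.single 2 G.root (1 : ℂ))).re

/-- `ν` is the expected spectral measure of the random rooted graph `Y`: `ν(X) = 𝔼[μ_{Y}(X)]`,
where `μ_{Y}` is the spectral measure of the adjacency operator of `Y` at the root. -/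
def IsExpectedSpectralMeasure {Ω : Type*} [MeasurableSpace Ω] (P : Measure Ω)
    (Y : Ω → RootedWeightedGraph) (ν : Measure ℝ) : Prop :=
  ∃ μ : Ω → Measure ℝ, AEMeasurable μ P ∧ (∀ᵐ ω ∂P, IsRootSpectralMeasure (Y ω) (μ ω)) ∧
    ∀ X, MeasurableSet X → ν X = ∫⁻ ω, μ ω X ∂P

/-- The chi-squared distribution with `k ≥ 0` degrees of freedom (the point mass at `0` for
`k = 0`). -/
noncomputable def chiSquaredMeasure (k : ℝ) : Measure ℝ :=
  if k = 0 then Measure.dirac 0 else gammaMeasure (k / 2) (1 / 2)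

/-- The chi distribution with `k ≥ 0` degrees of freedom. -/
noncomputable def chiMeasure (k : ℝ) : Measure ℝ := (chiSquaredMeasure k).map Real.sqrt

/-- The symmetric tridiagonal `n × n` matrix with diagonal `a 0, …, a (n-1)` and off-diagonal
`b 1, …, b (n-1)`. -/
def tridiag (n : ℕ) (a b : ℕ → ℝ) : Matrix (Fin n) (Fin n) ℝ :=
  Matrix.of fun i j =>
    if i = j then a i
    else if (i : ℕ) + 1 = j then b j
    else if (j : ℕ) + 1 = i then b i
    else 0

/-- The laws of the entries of the `β`-Laguerre matrix `L_β^(n) = tridiag n a b`, where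
`2α = βγ(n-1)`. (No assumption is made on the dependence between different entries.) -/
structure IsLaguerreEntries (β γ : ℝ) (n : ℕ) {Ω : Type*} [MeasurableSpace Ω] (P : Measure Ω)
    (a b : ℕ → Ω → ℝ) : Prop where
  diag_zero : HasLaw (a 0) ((chiSquaredMeasure (β * γ * (n - 1))).map fun x => x / n) P
  diag : ∀ j : ℕ, 1 ≤ j → j ≤ n - 1 →
    HasLaw (a j) ((chiSquaredMeasure (β * γ * (n - 1) + β * (n - 2 * j))).map fun x => x / n) P
  offDiag : ∀ j : ℕ, 1 ≤ j → j ≤ n - 1 →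
    HasLaw (b j) (((chiMeasure (β * γ * (n - 1) - β * (j - 1))).prod
      (chiMeasure (β * (n - j)))).map fun p => p.1 * p.2 / n) P

/-- The path on `n + 1` vertices, with loops, weighted by the matrix `tridiag (n + 1) a b`, and
rooted at `o`. -/
def tridiagGraph (n : ℕ) (a b : ℕ → ℝ) (o : Fin (n + 1)) : RootedWeightedGraph where
  V := Fin (n + 1)
  graph := SimpleGraph.pathGraph (n + 1)
  connected := SimpleGraph.pathGraph_connected n
  locallyFinite := fun _ => Set.toFinite _
  weight := fun i j => tridiag (n + 1) a b i j
  weight_symm := by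
    intro i j
    simp only [tridiag, Matrix.of_apply, Fin.ext_iff]
    split_ifs <;> first | rfl | omega | congr 1
  weight_eq_zero := by
    intro i j hij h
    rw [SimpleGraph.pathGraph_adj] at h
    simp only [tridiag, Matrix.of_apply]
    split_ifs <;> tauto
  root := o

/-- The graph `ℤ` rooted at `0`, all loops having weight `c` and all edges having weight `d`. -/
noncomputable def intGraph (c d : ℝ) : RootedWeightedGraph where
  V := ℤ
  graph := SimpleGraph.hasse ℤ
  connected := ⟨SimpleGraph.hasse_preconnected_of_succ ℤ⟩
  locallyFinite := by
    intro v
    refine (Set.toFinite {v + 1, v - 1}).subset fun w hw => ?_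
    simp only [SimpleGraph.mem_neighborSet, SimpleGraph.hasse_adj, Order.covBy_iff_add_one_eq] at hw
    simp only [Set.mem_insert_iff, Set.mem_singleton_iff]
    omega
  weight := fun i j => if i = j then c else if i + 1 = j ∨ j + 1 = i then d else 0
  weight_symm := by
    intro i j
    split_ifs <;> first | rfl | omega
  weight_eq_zero := by
    intro i j hij h
    simp only [SimpleGraph.hasse_adj, Order.covBy_iff_add_one_eq] at h
    simp [hij, h]
  root := 0

/-- The limiting graph at `u ∈ [0, 1]`: `ℤ` with loop weight `β(γ + 1 - 2u)` and edge weight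
`β√((γ - u)(1 - u))`. -/
noncomputable def laguerreLimitGraph (β γ : ℝ) (u : unitInterval) : RootedWeightedGraph :=
  intGraph (β * (γ + 1 - 2 * u)) (β * √((γ - u) * (1 - u)))

/-- The Marchenko–Pastur law on `[L₋, L₊]`, `L± = β(1 ± √γ)²`. -/
noncomputable def marchenkoPastur (β γ : ℝ) : Measure ℝ :=
  (volume.restrict (Set.Icc (β * (1 - √γ) ^ 2) (β * (1 + √γ) ^ 2))).withDensity fun x =>
    ENNReal.ofReal
      (√((x - β * (1 - √γ) ^ 2) * (β * (1 + √γ) ^ 2 - x)) / (2 * Real.pi * β * x))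

/-- The uniform distribution on the `n + 1` vertices of the path. -/
noncomputable def uniformRoot (n : ℕ) : Measure (Fin (n + 1)) :=
  (PMF.uniformOfFintype (Fin (n + 1))).toMeasure

instance (n : ℕ) : IsProbabilityMeasure (uniformRoot n) := by
  unfold uniformRoot
  infer_instance

/-! Concentration: every entry with index `j ≥ 1` is, up to the factor 1/n, a chi-squared variable
or a product of two chi variables with O(n) degrees of freedom. A Chernoff bound makes a deviation
by ε from the profiles β(γ+1-2j/n) and β√((γ-j/n)(1-j/n)) exponentially unlikely in n, uniformly in
j. A union bound and Borel–Cantelli then give almost sure uniform closeness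
(`ae_forall_eventually_entries_close`), whatever the dependence between entries.

Local limit: the uniform root is realized for all sizes at once as the vertex ⌊(n+1)u⌋ with a single
uniform u. For 0 < u < 1 a ball of fixed radius eventually avoids both ends of the path, and its
indices divided by the matrix size tend to u, so by continuity of the profiles its weights tend to
constants: the ball converges to that of ℤ (`tendsto_mk_tridiagGraph_floorVertex`). Almost sure
convergence under this coupling gives weak convergence of the laws, both for a fixed matrix and on
the product space.

Spectral measure: Fourier series turn the adjacency operator of ℤ with loops c and edges d into
multiplication by c + 2d cos(2πx), and the root vector into the constant 1. The root spectral
measure is therefore the law of this symbol, an arcsine law (`isRootSpectralMeasure_intGraph`,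
`map_intSymbol_apply`). In the mixture over u, the quantity under the square root of the arcsine
density is affine in u because the u² terms cancel; the integral is then elementary and yields the
Marchenko–Pastur density (`lintegral_arcsine_eq_marchenkoPastur_density`). -/

/-! ### Distances, balls and local closeness for the path and for ℤ. -/

/-- If the vertices of a connected graph have distinct integer coordinates filling an interval and
adjacency means that the coordinates differ by one, then distance is the difference of
coordinates. -/
theorem SimpleGraph.dist_eq_natAbs_sub {V : Type*} {G : SimpleGraph V} (hG : G.Connected)
    (h : V → ℤ) (hinj : Function.Injective h)
    (hadj : ∀ x y, G.Adj x y ↔ (h x - h y).natAbs = 1)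
    (hord : (Set.range h).OrdConnected) (x y : V) : G.dist x y = (h x - h y).natAbs := by
  apply le_antisymm
  · suffices H : ∀ k x, (h x - h y).natAbs = k → G.dist x y ≤ k from H _ x rfl
    intro k
    induction k with
    | zero =>
      intro x hx
      have : x = y := hinj (by omega)
      simp [this]
    | succ k ih =>
      intro x hx
      obtain ⟨z, hz1, hz2⟩ : ∃ z, (h x - h z).natAbs = 1 ∧ (h z - h y).natAbs = k := by
        rcases le_total (h x) (h y) with hxy | hxy
        · obtain ⟨z, hz⟩ := hord.out ⟨x, rfl⟩ ⟨y, rfl⟩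
            (show h x + 1 ∈ Set.Icc (h x) (h y) from ⟨by omega, by omega⟩)
          exact ⟨z, by omega, by omega⟩
        · obtain ⟨z, hz⟩ := hord.out ⟨y, rfl⟩ ⟨x, rfl⟩
            (show h x - 1 ∈ Set.Icc (h y) (h x) from ⟨by omega, by omega⟩)
          exact ⟨z, by omega, by omega⟩
      have h1 := hG.dist_triangle (u := x) (v := z) (w := y)
      rw [SimpleGraph.dist_eq_one_iff_adj.2 ((hadj x z).2 hz1)] at h1
      have := ih z hz2
      omega
  -- Each step of a walk changes the coordinate by one, so no walk is shorter than the difference.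
  · obtain ⟨p, hp⟩ := hG.exists_walk_length_eq_dist x y
    rw [← hp]
    clear hp
    induction p with
    | nil => simp
    | cons hxy q ih =>
      rw [SimpleGraph.Walk.length_cons]
      have := (hadj _ _).1 hxy
      omega

namespace RootedWeightedGraph

theorem mem_ball_intGraph {c d : ℝ} {r : ℕ} (v : ℤ) :
    v ∈ (intGraph c d).ball r ↔ v.natAbs ≤ r := by
  have hc : (SimpleGraph.hasse ℤ).Connected := ⟨SimpleGraph.hasse_preconnected_of_succ ℤ⟩
  have h := SimpleGraph.dist_eq_natAbs_sub hc (fun v : ℤ => v)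
    (fun _ _ h => h)
    (fun x y => by
      simp only [SimpleGraph.hasse_adj, Order.covBy_iff_add_one_eq]
      omega)
    (by rw [Set.range_id']; exact Set.ordConnected_univ) (0 : ℤ) v
  change (SimpleGraph.hasse ℤ).dist (0 : ℤ) v ≤ r ↔ _
  rw [h]
  omega

theorem mem_ball_tridiagGraph {n : ℕ} {a b : ℕ → ℝ} {o : Fin (n + 1)} {r : ℕ} (i : Fin (n + 1)) :
    i ∈ (tridiagGraph n a b o).ball r ↔ ((i : ℤ) - (o : ℤ)).natAbs ≤ r := by
  have h := SimpleGraph.dist_eq_natAbs_sub (SimpleGraph.pathGraph_connected n)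
    (fun v : Fin (n + 1) => ((v : ℕ) : ℤ))
    (fun i j h => Fin.ext (by simpa using h))
    (fun x y => by
      rw [SimpleGraph.pathGraph_adj]
      omega)
    ⟨by
      rintro _ ⟨x, rfl⟩ _ ⟨y, rfl⟩ z ⟨hz1, hz2⟩
      dsimp only at hz1 hz2
      exact ⟨⟨z.toNat, by omega⟩, by dsimp only; omega⟩⟩ o i
  change (SimpleGraph.pathGraph (n + 1)).dist o i ≤ r ↔ _
  rw [h]
  omega

/-- The maps live on the full vertex sets and need to be mutually inverse on the balls only, which
keeps subtypes out of the applications. -/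
theorem LocallyClose.of_maps {G H : RootedWeightedGraph} {r : ℕ} {ε : ℝ} (f : G.V → H.V)
    (g : H.V → G.V) (hf : ∀ v ∈ G.ball r, f v ∈ H.ball r) (hg : ∀ v ∈ H.ball r, g v ∈ G.ball r)
    (hgf : ∀ v ∈ G.ball r, g (f v) = v) (hfg : ∀ v ∈ H.ball r, f (g v) = v)
    (hadj : ∀ u ∈ G.ball r, ∀ v ∈ G.ball r, H.graph.Adj (f u) (f v) ↔ G.graph.Adj u v)
    (hroot : f G.root = H.root)
    (hw : ∀ u ∈ G.ball r, ∀ v ∈ G.ball r, |H.weight (f u) (f v) - G.weight u v| < ε) :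
    LocallyClose r ε G H :=
  ⟨⟨{ toFun := fun v => ⟨f v, hf v v.2⟩
      invFun := fun v => ⟨g v, hg v v.2⟩
      left_inv := fun v => Subtype.ext (hgf v v.2)
      right_inv := fun v => Subtype.ext (hfg v v.2) },
    fun {u v} => hadj u u.2 v v.2⟩, hroot, fun u v => hw u u.2 v v.2⟩

theorem abs_tridiag_sub_weight_lt {n r : ℕ} {a b : ℕ → ℝ} {o i j : Fin (n + 1)} {c d ε : ℝ}
    (hε : 0 < ε) {u v : ℤ} (hi : (i : ℤ) = u + o) (hj : (j : ℤ) = v + o) (hu : u.natAbs ≤ r)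
    (hv : v.natAbs ≤ r)
    (hab : ∀ j : ℕ, o ≤ j + r → j ≤ o + r → |a j - c| < ε ∧ |b j - d| < ε) :
    |tridiag (n + 1) a b i j -
      (if u = v then c else if u + 1 = v ∨ v + 1 = u then d else 0)| < ε := by
  have hi' := hab i (by omega) (by omega)
  have hj' := hab j (by omega) (by omega)
  simp only [tridiag, Matrix.of_apply, Fin.ext_iff]
  split_ifs <;> first | omega | simp_all

theorem locallyClose_intGraph_tridiagGraph {n r : ℕ} {a b : ℕ → ℝ} {o : Fin (n + 1)} {c d ε : ℝ}
    (hε : 0 < ε) (h1 : r ≤ (o : ℕ)) (h2 : o + r ≤ n)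
    (hab : ∀ j : ℕ, o ≤ j + r → j ≤ o + r → |a j - c| < ε ∧ |b j - d| < ε) :
    LocallyClose r ε (intGraph c d) (tridiagGraph n a b o) := by
  -- Translation by `o`, truncated to the path; since `r ≤ o` and `o + r ≤ n`, the truncation is
  -- inactive on the ball.
  let f : ℤ → Fin (n + 1) := fun v => ⟨min (v + o).toNat n, by omega⟩
  let g : Fin (n + 1) → ℤ := fun i => (i : ℤ) - (o : ℤ)
  have hG : ∀ v : ℤ, v ∈ (intGraph c d).ball r ↔ v.natAbs ≤ r := mem_ball_intGraph
  have hH : ∀ i : Fin (n + 1), i ∈ (tridiagGraph n a b o).ball r ↔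
    ((i : ℤ) - (o : ℤ)).natAbs ≤ r := mem_ball_tridiagGraph
  have hf : ∀ v : ℤ, v.natAbs ≤ r → ((f v : ℕ) : ℤ) = v + o := fun v hv => by
    dsimp only [f]
    omega
  refine LocallyClose.of_maps f g (fun (v : ℤ) hv => ?_) (fun (v : Fin (n + 1)) hv => ?_)
    (fun (v : ℤ) hv => ?_) (fun (v : Fin (n + 1)) hv => ?_)
    (fun (u : ℤ) hu (v : ℤ) hv => ?_) ?_ (fun (u : ℤ) hu (v : ℤ) hv => ?_)
  · refine (hH _).2 ?_
    have hv' := (hG v).1 hv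
    rw [hf v hv', add_sub_cancel_right]
    exact hv'
  · exact (hG _).2 ((hH v).1 hv)
  · have h := hf v ((hG v).1 hv)
    change ((f v : ℕ) : ℤ) - (o : ℤ) = v
    omega
  · have h := hf (g v) ((hH v).1 hv)
    refine Fin.ext ?_
    change ((f (g v) : ℕ) : ℤ) = ((v : Fin (n + 1)) : ℤ) - (o : ℤ) + o at h
    omega
  · have hu := hf u ((hG u).1 hu)
    have hv := hf v ((hG v).1 hv)
    change (SimpleGraph.pathGraph (n + 1)).Adj (f u) (f v) ↔ (SimpleGraph.hasse ℤ).Adj u v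
    rw [SimpleGraph.pathGraph_adj, SimpleGraph.hasse_adj, Order.covBy_iff_add_one_eq,
      Order.covBy_iff_add_one_eq]
    omega
  · have h := hf 0 (by simp)
    refine Fin.ext ?_
    change ((f 0 : ℕ)) = (o : ℕ)
    omega
  · replace hu := (hG u).1 hu
    replace hv := (hG v).1 hv
    exact abs_tridiag_sub_weight_lt hε (hf u hu) (hf v hv) hu hv hab

theorem locallyClose_intGraph {c d c' d' ε : ℝ} (r : ℕ) (hε : 0 < ε) (hc : |c' - c| < ε)
    (hd : |d' - d| < ε) : LocallyClose r ε (intGraph c d) (intGraph c' d') := by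
  refine LocallyClose.of_maps (fun v => v) (fun v => v) (fun v hv => hv) (fun v hv => hv)
    (fun _ _ => rfl) (fun _ _ => rfl) (fun _ _ _ _ => Iff.rfl) rfl fun (u : ℤ) _ (v : ℤ) _ => ?_
  change |(if u = v then c' else if u + 1 = v ∨ v + 1 = u then d' else 0) -
      (if u = v then c else if u + 1 = v ∨ v + 1 = u then d else 0)| < ε
  split_ifs <;> simpa

theorem locallyClose_tridiagGraph {n : ℕ} {a b a' b' : ℕ → ℝ} (o : Fin (n + 1)) {ε : ℝ} (r : ℕ)
    (hε : 0 < ε) (ha : ∀ j ≤ n, |a' j - a j| < ε) (hb : ∀ j ≤ n, |b' j - b j| < ε) :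
    LocallyClose r ε (tridiagGraph n a b o) (tridiagGraph n a' b' o) := by
  refine LocallyClose.of_maps (fun v => v) (fun v => v) (fun v hv => hv) (fun v hv => hv)
    (fun _ _ => rfl) (fun _ _ => rfl) (fun _ _ _ _ => Iff.rfl) rfl
    fun (i : Fin (n + 1)) _ (j : Fin (n + 1)) _ => ?_
  change |tridiag (n + 1) a' b' i j - tridiag (n + 1) a b i j| < ε
  simp only [tridiag, Matrix.of_apply]
  split_ifs
  · exact ha _ (by omega)
  · exact hb _ (by omega)
  · exact hb _ (by omega)
  · simpa

end RootedWeightedGraph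

open RootedWeightedGraph

/-! ### Continuity and measurability of isomorphism classes in the weights. -/

namespace RootedGraphClass

theorem continuous_mk : Continuous mk := continuous_quot_mk

theorem tendsto_mk {ι : Type*} {l : Filter ι} {X : ι → RootedWeightedGraph}
    {G : RootedWeightedGraph}
    (h : ∀ r : ℕ, ∀ ε : ℝ, 0 < ε → ∀ᶠ i in l, LocallyClose r ε G (X i)) :
    Tendsto (fun i => mk (X i)) l (𝓝 (mk G)) := by
  rw [tendsto_nhds]
  intro U hU hG
  obtain ⟨r, ε, hε, hr⟩ := hU.preimage continuous_mk G hG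
  exact (h r ε hε).mono fun i hi => hr _ hi

theorem continuous_mk_intGraph : Continuous fun p : ℝ × ℝ => mk (intGraph p.1 p.2) := by
  refine continuous_iff_continuousAt.2 fun p => tendsto_mk fun r ε hε => ?_
  filter_upwards [Metric.ball_mem_nhds p hε] with q hq
  rw [Metric.mem_ball, Prod.dist_eq, max_lt_iff, Real.dist_eq, Real.dist_eq] at hq
  exact locallyClose_intGraph r hε hq.1 hq.2

theorem continuous_mk_tridiagGraph (n : ℕ) (o : Fin (n + 1)) :
    Continuous fun p : (ℕ → ℝ) × (ℕ → ℝ) => mk (tridiagGraph n p.1 p.2 o) := by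
  refine continuous_iff_continuousAt.2 fun p => tendsto_mk fun r ε hε => ?_
  have h1 : ∀ j, ∀ᶠ q in 𝓝 p, |q.1 j - p.1 j| < ε := fun j => by
    have : Continuous fun q : (ℕ → ℝ) × (ℕ → ℝ) => |q.1 j - p.1 j| := by fun_prop
    exact this.continuousAt.eventually_lt continuousAt_const (by simpa)
  have h2 : ∀ j, ∀ᶠ q in 𝓝 p, |q.2 j - p.2 j| < ε := fun j => by
    have : Continuous fun q : (ℕ → ℝ) × (ℕ → ℝ) => |q.2 j - p.2 j| := by fun_prop
    exact this.continuousAt.eventually_lt continuousAt_const (by simpa)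
  filter_upwards [(Set.finite_Iic n).eventually_all.2 fun j _ => h1 j,
    (Set.finite_Iic n).eventually_all.2 fun j _ => h2 j] with q hq1 hq2
  exact locallyClose_tridiagGraph o r hε hq1 hq2

/-- Only the diagonal entries `0, …, n` and the off-diagonal entries `1, …, n` matter. -/
theorem mk_tridiagGraph_congr {n : ℕ} {a b a' b' : ℕ → ℝ} (o : Fin (n + 1))
    (ha : ∀ j ≤ n, a j = a' j) (hb : ∀ j, 1 ≤ j → j ≤ n → b j = b' j) :
    mk (tridiagGraph n a b o) = mk (tridiagGraph n a' b' o) := by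
  refine Quotient.sound ⟨(SimpleGraph.Iso.refl : (tridiagGraph n a b o).graph ≃g
    (tridiagGraph n a b o).graph), rfl, fun (i j : Fin (n + 1)) => ?_⟩
  change tridiag (n + 1) a' b' i j = tridiag (n + 1) a b i j
  simp only [tridiag, Matrix.of_apply]
  split_ifs
  · exact (ha _ (by omega)).symm
  · exact (hb _ (by omega) (by omega)).symm
  · exact (hb _ (by omega) (by omega)).symm
  · rfl

theorem aemeasurable_mk_tridiagGraph {Ω : Type*} [MeasurableSpace Ω] {P : Measure Ω} {n : ℕ}
    {a b : ℕ → Ω → ℝ} (ha : ∀ j ≤ n, AEMeasurable (a j) P)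
    (hb : ∀ j, 1 ≤ j → j ≤ n → AEMeasurable (b j) P) (o : Fin (n + 1)) :
    AEMeasurable (fun ω => mk (tridiagGraph n (fun j => a j ω) (fun j => b j ω) o)) P := by
  -- Measurability is known only for entries that occur in the matrix; the others are replaced by 0,
  -- which does not change the graph class.
  have h1 : AEMeasurable (fun ω => ((fun j => if j ≤ n then a j ω else 0),
      (fun j => if 1 ≤ j ∧ j ≤ n then b j ω else 0)) : Ω → (ℕ → ℝ) × (ℕ → ℝ)) P := by
    refine AEMeasurable.prodMk (aemeasurable_pi_lambda _ fun j => ?_)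
      (aemeasurable_pi_lambda _ fun j => ?_)
    · split_ifs with h
      · exact ha j h
      · exact aemeasurable_const
    · split_ifs with h
      · exact hb j h.1 h.2
      · exact aemeasurable_const
  refine ((continuous_mk_tridiagGraph n o).measurable.comp_aemeasurable h1).congr
    (ae_of_all _ fun ω => mk_tridiagGraph_congr o (fun j hj => ?_) (fun j hj hj' => ?_))
  · simp [hj]
  · simp [hj, hj']

theorem continuous_mk_laguerreLimitGraph (β γ : ℝ) :
    Continuous fun u => mk (laguerreLimitGraph β γ u) := by
  have h : Continuous fun u : unitInterval =>
      (β * (γ + 1 - 2 * (u : ℝ)), β * √((γ - u) * (1 - u))) := by fun_prop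
  exact continuous_mk_intGraph.comp h

end RootedGraphClass

/-! ### Exponential concentration of chi-squared variables. -/

/-- Exponential tilting: multiplying the Gamma density of rate r by exp(tx) gives a constant times
the Gamma density of rate r - t. -/
theorem lintegral_exp_gammaMeasure {a r t : ℝ} (ha : 0 < a) (hr : 0 < r) (ht : t < r) :
    ∫⁻ x, ENNReal.ofReal (Real.exp (t * x)) ∂(gammaMeasure a r) =
      ENNReal.ofReal ((r / (r - t)) ^ a) := by
  have hrt : 0 < r - t := by linarith
  have key : ∀ x, gammaPDF a r x * ENNReal.ofReal (Real.exp (t * x)) =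
      ENNReal.ofReal ((r / (r - t)) ^ a) * gammaPDF a (r - t) x := fun x => by
    rcases lt_or_ge x 0 with hx | hx
    · simp [gammaPDF_of_neg hx]
    · rw [gammaPDF_of_nonneg hx, gammaPDF_of_nonneg hx, ← ENNReal.ofReal_mul (by positivity),
        ← ENNReal.ofReal_mul (by positivity)]
      congr 1
      rw [Real.div_rpow hr.le hrt.le, show -((r - t) * x) = -(r * x) + t * x by ring, Real.exp_add]
      have := (Real.rpow_pos_of_pos hrt a).ne'
      field_simp
  have hm : Measurable fun x => ENNReal.ofReal (Real.exp (t * x)) := by fun_prop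
  have hp : ∀ s, Measurable (gammaPDF a s) := fun s =>
    (measurable_gammaPDFReal a s).ennreal_ofReal
  rw [gammaMeasure, lintegral_withDensity_eq_lintegral_mul _ (hp r) hm]
  simp only [Pi.mul_apply, key]
  rw [lintegral_const_mul _ (hp _), lintegral_gammaPDF_eq_one ha hrt, mul_one]

theorem isProbabilityMeasure_chiSquaredMeasure {k : ℝ} (hk : 0 ≤ k) :
    IsProbabilityMeasure (chiSquaredMeasure k) := by
  unfold chiSquaredMeasure
  split_ifs with h
  · infer_instance
  · exact isProbabilityMeasure_gammaMeasure (by positivity) (by norm_num)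

/-- The logarithm of the moment generating function is -(k/2) log(1-2t), bounded through -log s ≤
1/s - 1. Negative t is allowed, so one estimate serves both tails. -/
theorem lintegral_exp_chiSquaredMeasure_le {k t : ℝ} (hk : 0 ≤ k) (ht : t ≤ 1 / 4) :
    ∫⁻ x, ENNReal.ofReal (Real.exp (t * x)) ∂(chiSquaredMeasure k) ≤
      ENNReal.ofReal (Real.exp (k * t + 4 * k * t ^ 2)) := by
  unfold chiSquaredMeasure
  split_ifs with h
  · rw [lintegral_dirac' _ (by fun_prop)]
    simp [h]
  · rw [lintegral_exp_gammaMeasure (by positivity) (by norm_num) (by linarith)]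
    apply ENNReal.ofReal_le_ofReal
    have hs : 0 < 1 - 2 * t := by linarith
    have h1 : (1 / 2 / (1 / 2 - t)) = (1 - 2 * t)⁻¹ := by
      field_simp
    rw [h1, Real.rpow_def_of_pos (by positivity), Real.log_inv, Real.exp_le_exp]
    have h2 := Real.one_sub_inv_le_log_of_pos hs
    -- Multiplied out, this is 0 ≤ 4t²(1 - 4t), which is where t ≤ 1/4 enters.
    have h3 : (1 - 2 * t)⁻¹ ≤ 1 + 2 * t + 8 * t ^ 2 := by
      rw [inv_le_iff_one_le_mul₀ hs]
      nlinarith [sq_nonneg t, mul_nonneg (sq_nonneg t) (show 0 ≤ 1 - 4 * t by linarith)]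
    nlinarith

theorem chiSquaredMeasure_setOf_le {k t s : ℝ} (hk : 0 ≤ k) (ht : t ≤ 1 / 4) :
    chiSquaredMeasure k {x | s ≤ t * (x - k)} ≤ ENNReal.ofReal (Real.exp (4 * k * t ^ 2 - s)) := by
  have h := mul_meas_ge_le_lintegral (μ := chiSquaredMeasure k)
    (f := fun x => ENNReal.ofReal (Real.exp (t * x))) (by fun_prop)
    (ENNReal.ofReal (Real.exp (s + t * k)))
  have hset : {x | ENNReal.ofReal (Real.exp (s + t * k)) ≤ ENNReal.ofReal (Real.exp (t * x))} =
      {x | s ≤ t * (x - k)} := by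
    ext x
    simp only [Set.mem_ofPred_eq]
    rw [ENNReal.ofReal_le_ofReal_iff (Real.exp_pos _).le, Real.exp_le_exp]
    constructor <;> intro h <;> linarith
  rw [hset] at h
  have h2 := h.trans (lintegral_exp_chiSquaredMeasure_le hk ht)
  calc chiSquaredMeasure k {x | s ≤ t * (x - k)}
      = ENNReal.ofReal (Real.exp (-(s + t * k))) * (ENNReal.ofReal (Real.exp (s + t * k)) *
          chiSquaredMeasure k {x | s ≤ t * (x - k)}) := by
        rw [← mul_assoc, ← ENNReal.ofReal_mul (Real.exp_pos _).le, ← Real.exp_add]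
        simp
    _ ≤ ENNReal.ofReal (Real.exp (-(s + t * k))) *
          ENNReal.ofReal (Real.exp (k * t + 4 * k * t ^ 2)) := by gcongr
    _ = _ := by
        rw [← ENNReal.ofReal_mul (Real.exp_pos _).le, ← Real.exp_add]
        ring_nf

theorem exists_chiSquaredMeasure_tail_le {K ε : ℝ} (hK : 0 < K) (hε : 0 < ε) :
    ∃ c : ℝ, 0 < c ∧ ∀ (n : ℕ) (k : ℝ), 0 ≤ k → k ≤ K * n →
      chiSquaredMeasure k {x | ε * n ≤ |x - k|} ≤ ENNReal.ofReal (2 * Real.exp (-c * n)) := by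
  obtain ⟨t, ht0, ht1, ht2⟩ : ∃ t : ℝ, 0 < t ∧ t ≤ 1 / 4 ∧ 8 * K * t ≤ ε := by
    -- With 8Kt ≤ ε the quadratic term 4kt² ≤ 4Knt² uses at most half of the gain tεn, leaving the
    -- rate tε/2 for every k ≤ Kn.
    refine ⟨min (1 / 4) (ε / (8 * K)), by positivity, min_le_left _ _, ?_⟩
    have h := min_le_right (1 / 4) (ε / (8 * K))
    rw [le_div_iff₀ (by positivity)] at h
    linarith
  refine ⟨t * ε / 2, by positivity, fun n k hk hkn => ?_⟩
  have hsub : {x | ε * n ≤ |x - k|} ⊆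
      {x | t * (ε * n) ≤ t * (x - k)} ∪ {x | t * (ε * n) ≤ -t * (x - k)} := by
    intro x hx
    rcases le_abs.1 hx.out with h | h
    · exact Or.inl (mul_le_mul_of_nonneg_left h ht0.le)
    · refine Or.inr ?_
      have := mul_le_mul_of_nonneg_left h ht0.le
      simp only [Set.mem_ofPred_eq]
      linarith
  have hexp : 4 * k * t ^ 2 - t * (ε * n) ≤ -(t * ε / 2) * n := by
    have h1 : 4 * k * t ^ 2 ≤ 4 * (K * n) * t ^ 2 := by gcongr
    have h2 : (8 * K * t) * (t * n) ≤ ε * (t * n) := by gcongr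
    nlinarith
  refine (measure_mono hsub).trans ((measure_union_le _ _).trans ?_)
  rw [two_mul, ENNReal.ofReal_add (Real.exp_pos _).le (Real.exp_pos _).le]
  refine add_le_add ((chiSquaredMeasure_setOf_le hk ht1).trans ?_)
    ((chiSquaredMeasure_setOf_le hk (by linarith)).trans ?_)
  · exact ENNReal.ofReal_le_ofReal (Real.exp_le_exp.2 hexp)
  · exact ENNReal.ofReal_le_ofReal (Real.exp_le_exp.2 (by rwa [neg_sq]))

theorem chiMeasure_prod_apply {p q : ℝ} (hp : 0 ≤ p) (hq : 0 ≤ q) {S : Set ℝ}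
    (hS : MeasurableSet S) (n : ℝ) :
    (((chiMeasure p).prod (chiMeasure q)).map fun z => z.1 * z.2 / n) S =
      ((chiSquaredMeasure p).prod (chiSquaredMeasure q)) {z | √z.1 * √z.2 / n ∈ S} := by
  have := isProbabilityMeasure_chiSquaredMeasure hp
  have := isProbabilityMeasure_chiSquaredMeasure hq
  have hs : Measurable Real.sqrt := by fun_prop
  rw [chiMeasure, chiMeasure, Measure.map_prod_map _ _ hs hs, Measure.map_map (by fun_prop)
    (by fun_prop), Measure.map_apply (by fun_prop) hS]
  rfl

theorem abs_sqrt_sub_sqrt_le_sqrt (x y : ℝ) : |√x - √y| ≤ √|x - y| := by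
  have key : ∀ x y : ℝ, √x ≤ √y + √|x - y| := fun x y => by
    rcases le_or_gt y 0 with hy | hy
    · rw [Real.sqrt_eq_zero_of_nonpos hy, zero_add]
      exact Real.sqrt_le_sqrt (by rw [le_abs]; left; linarith)
    · refine Real.sqrt_le_iff.2 ⟨by positivity, ?_⟩
      rw [add_sq, Real.sq_sqrt hy.le, Real.sq_sqrt (abs_nonneg _)]
      have := le_abs_self (x - y)
      have : 0 ≤ 2 * √y * √|x - y| := by positivity
      linarith
  rw [abs_le]
  have h1 := key x y
  have h2 := key y x
  rw [abs_sub_comm y x] at h2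
  constructor <;> linarith

/-- The square root is 1/2-Hölder on the whole line, so no lower bound on p and q is needed. This
keeps the estimate uniform up to the end of the path where the second chi factor degenerates. -/
theorem abs_sqrt_mul_sqrt_div_sub_le {x y p q δ K n : ℝ} (hn : 0 < n) (hδ1 : δ ≤ 1)
    (hpK : p ≤ K) (hqK : q ≤ K)
    (hx : |x - p * n| < δ * n) (hy : |y - q * n| < δ * n) :
    |√x * √y / n - √p * √q| ≤ √δ * (2 * √(K + 1)) := by
  have hx' : |√(x / n) - √p| ≤ √δ := by
    refine (abs_sqrt_sub_sqrt_le_sqrt _ _).trans (Real.sqrt_le_sqrt ?_)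
    rw [show x / n - p = (x - p * n) / n by field_simp, abs_div, abs_of_pos hn,
      div_le_iff₀ hn]
    exact hx.le
  have hy' : |√(y / n) - √q| ≤ √δ := by
    refine (abs_sqrt_sub_sqrt_le_sqrt _ _).trans (Real.sqrt_le_sqrt ?_)
    rw [show y / n - q = (y - q * n) / n by field_simp, abs_div, abs_of_pos hn,
      div_le_iff₀ hn]
    exact hy.le
  have hyK : √(y / n) ≤ √(K + 1) := by
    refine Real.sqrt_le_sqrt ?_
    rw [div_le_iff₀ hn]
    have := (abs_lt.1 hy).2
    nlinarith
  have hp : √p ≤ √(K + 1) := Real.sqrt_le_sqrt (by linarith)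
  have hn' : n = √n * √n := (Real.mul_self_sqrt hn.le).symm
  have e : √x * √y / n - √p * √q = (√(x / n) - √p) * √(y / n) + √p * (√(y / n) - √q) := by
    rw [Real.sqrt_div' _ hn.le, Real.sqrt_div' _ hn.le]
    have h0 : √n ≠ 0 := (Real.sqrt_pos.2 hn).ne'
    nth_rewrite 1 [hn']
    field_simp
    ring
  rw [e]
  calc _ ≤ |√(x / n) - √p| * √(y / n) + √p * |√(y / n) - √q| := by
        refine (abs_add_le _ _).trans (le_of_eq ?_)
        rw [abs_mul, abs_mul, abs_of_nonneg (Real.sqrt_nonneg (y / n)),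
          abs_of_nonneg (Real.sqrt_nonneg p)]
    _ ≤ √δ * √(K + 1) + √(K + 1) * √δ := by gcongr
    _ = _ := by ring

/-- Union bound plus Borel–Cantelli: Σ n·C·exp(-cn) is finite. Nothing is assumed about the joint
law of the events. -/
theorem ae_eventually_forall_notMem {Ω : Type*} [MeasurableSpace Ω] {P : Measure Ω}
    {B : ℕ → ℕ → Set Ω} {C c : ℝ} (hC : 0 ≤ C) (hc : 0 < c)
    (hB : ∀ᶠ n in atTop, ∀ j, 1 ≤ j → j ≤ n - 1 →
      P (B n j) ≤ ENNReal.ofReal (C * Real.exp (-c * n))) :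
    ∀ᵐ ω ∂P, ∀ᶠ n in atTop, ∀ j, 1 ≤ j → j ≤ n - 1 → ω ∉ B n j := by
  obtain ⟨N, hN⟩ := eventually_atTop.1 hB
  -- Taken empty below the threshold `N`, so that the summable bound holds for every n.
  let s : ℕ → Set Ω := fun n => if N ≤ n then ⋃ j ∈ Finset.Icc 1 (n - 1), B n j else ∅
  have hs : ∀ n, P (s n) ≤ ENNReal.ofReal (C * (n ^ 1 * Real.exp (-c * n))) := fun n => by
    dsimp only [s]
    split_ifs with h
    · refine (measure_biUnion_finset_le _ _).trans ((Finset.sum_le_card_nsmul _ _ _ fun j hj =>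
        hN n h j (Finset.mem_Icc.1 hj).1 (Finset.mem_Icc.1 hj).2).trans ?_)
      rw [Nat.card_Icc, nsmul_eq_mul, ← ENNReal.ofReal_natCast,
        ← ENNReal.ofReal_mul (Nat.cast_nonneg _)]
      apply ENNReal.ofReal_le_ofReal
      have : ((n - 1 + 1 - 1 : ℕ) : ℝ) ≤ n := by exact_mod_cast (by omega)
      calc _ ≤ (n : ℝ) * (C * Real.exp (-c * n)) := by gcongr
        _ = _ := by ring
    · simp
  have hsum : ∑' n, P (s n) ≠ ⊤ := by
    refine ne_top_of_le_ne_top ?_ (ENNReal.tsum_le_tsum hs)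
    exact ((Real.summable_pow_mul_exp_neg_nat_mul 1 hc).mul_left C).tsum_ofReal_ne_top
  filter_upwards [ae_eventually_notMem hsum] with ω hω
  filter_upwards [hω, eventually_ge_atTop N] with n hn hnN j hj hj'
  simp only [s, if_pos hnN, Set.mem_iUnion, not_exists] at hn
  exact hn j (Finset.mem_Icc.2 ⟨hj, hj'⟩)

/-! ### Almost sure closeness of the matrix entries to their profiles. -/

section Laguerre

variable {β γ : ℝ} {Ω : Type*} [MeasurableSpace Ω] {P : Measure Ω} {a b : ℕ → ℕ → Ω → ℝ}

theorem ae_eventually_diag_close (hβ : 0 < β) (hγ : 1 ≤ γ)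
    (hL : ∀ n, 1 ≤ n → IsLaguerreEntries β γ n P (a n) (b n)) {ε : ℝ} (hε : 0 < ε) :
    ∀ᵐ ω ∂P, ∀ᶠ n : ℕ in atTop, ∀ j : ℕ, 1 ≤ j → j ≤ n - 1 →
      |a n j ω - β * (γ + 1 - 2 * (j / n))| < ε := by
  have hK : 0 < β * (γ + 1) := by positivity
  obtain ⟨c, hc, hb⟩ := exists_chiSquaredMeasure_tail_le hK (half_pos hε)
  have h := ae_eventually_forall_notMem (P := P)
    (B := fun n j => {ω | ε ≤ |a n j ω - β * (γ + 1 - 2 * (j / n))|}) zero_le_two hc ?_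
  · simpa using h
  have hlarge : ∀ᶠ n : ℕ in atTop, β * γ ≤ ε / 2 * n :=
    (tendsto_natCast_atTop_atTop.const_mul_atTop (half_pos hε)).eventually_ge_atTop _
  filter_upwards [hlarge, eventually_ge_atTop 1] with n hn hn1 j hj hj'
  have hn0 : (0 : ℝ) < n := by exact_mod_cast hn1
  have hjn : (j : ℝ) + 1 ≤ n := by exact_mod_cast (by omega)
  have hj1 : (1 : ℝ) ≤ j := by exact_mod_cast hj
  rw [((hL n hn1).diag j hj hj').measure_eq (p := fun x => ε ≤ |x - β * (γ + 1 - 2 * (j / n))|)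
      (measurableSet_le (by fun_prop) (by fun_prop)),
    Measure.map_apply (by fun_prop) (measurableSet_le (by fun_prop) (by fun_prop))]
  refine (measure_mono ?_).trans (hb n _ ?_ ?_)
  · intro x hx
    simp only [Set.preimage_ofPred_eq, Set.mem_ofPred_eq] at hx ⊢
    -- The degrees of freedom equal n times the profile minus βγ; this bounded shift costs half of ε
    -- once n is large.
    have e : x / n - β * (γ + 1 - 2 * (j / n)) =
        (x - (β * γ * (n - 1) + β * (n - 2 * j)) - β * γ) / n := by
      field_simp
      ring
    rw [e, abs_div, abs_of_pos hn0, le_div_iff₀ hn0] at hx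
    have h2 := abs_sub (x - (β * γ * (n - 1) + β * (n - 2 * j))) (β * γ)
    rw [abs_of_pos (show 0 < β * γ by positivity)] at h2
    linarith
  · nlinarith [mul_nonneg hβ.le (show 0 ≤ (γ - 1) * ((n : ℝ) - 1) from
      mul_nonneg (by linarith) (by linarith))]
  · nlinarith

theorem ae_eventually_offDiag_close (hβ : 0 < β) (hγ : 1 ≤ γ)
    (hL : ∀ n, 1 ≤ n → IsLaguerreEntries β γ n P (a n) (b n)) {ε : ℝ} (hε : 0 < ε) :
    ∀ᵐ ω ∂P, ∀ᶠ n : ℕ in atTop, ∀ j : ℕ, 1 ≤ j → j ≤ n - 1 →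
      |b n j ω - β * √((γ - j / n) * (1 - j / n))| < ε := by
  have hK : 0 < β * (γ + 1) := by positivity
  set K := β * (γ + 1) with hKdef
  obtain ⟨δ, hδ, hδ1, hδε⟩ : ∃ δ : ℝ, 0 < δ ∧ δ ≤ 1 ∧ √δ * (2 * √(K + 1)) < ε := by
    -- Chosen to make the Hölder error √δ·2√(K+1) at most ε/2.
    refine ⟨min 1 ((ε / (4 * √(K + 1))) ^ 2), by positivity, min_le_left _ _, ?_⟩
    have h1 : √(min 1 ((ε / (4 * √(K + 1))) ^ 2)) ≤ ε / (4 * √(K + 1)) := by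
      rw [Real.sqrt_le_iff]
      exact ⟨by positivity, min_le_right _ _⟩
    have h0 : 0 < √(K + 1) := by positivity
    calc _ ≤ ε / (4 * √(K + 1)) * (2 * √(K + 1)) := by gcongr
      _ = ε / 2 := by field_simp; norm_num
      _ < ε := half_lt_self hε
  obtain ⟨c, hc, hb⟩ := exists_chiSquaredMeasure_tail_le hK (half_pos hδ)
  have h := ae_eventually_forall_notMem (P := P)
    (B := fun n j => {ω | ε ≤ |b n j ω - β * √((γ - j / n) * (1 - j / n))|}) (C := 4)
    (by norm_num) hc ?_
  · simpa using h
  have hlarge : ∀ᶠ n : ℕ in atTop, β * γ ≤ δ / 2 * n :=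
    (tendsto_natCast_atTop_atTop.const_mul_atTop (half_pos hδ)).eventually_ge_atTop _
  filter_upwards [hlarge, eventually_ge_atTop 1] with n hn hn1 j hj hj'
  have hn0 : (0 : ℝ) < n := by exact_mod_cast hn1
  have hjn : (j : ℝ) + 1 ≤ n := by exact_mod_cast (by omega)
  have hj1 : (1 : ℝ) ≤ j := by exact_mod_cast hj
  have hS : MeasurableSet {x : ℝ | ε ≤ |x - β * √((γ - j / n) * (1 - j / n))|} :=
    measurableSet_le (by fun_prop) (by fun_prop)
  set p := β * γ * (n - 1) - β * (j - 1) with hpdef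
  set q := β * ((n : ℝ) - j) with hqdef
  have hp0 : 0 ≤ p := by
    nlinarith [mul_nonneg hβ.le (show 0 ≤ (γ - 1) * ((n : ℝ) - 1) from
      mul_nonneg (by linarith) (by linarith))]
  have hq0 : 0 ≤ q := mul_nonneg hβ.le (by linarith)
  have hpK : p ≤ K * n := by nlinarith
  have hqK : q ≤ K * n := by nlinarith
  have := isProbabilityMeasure_chiSquaredMeasure hp0
  have := isProbabilityMeasure_chiSquaredMeasure hq0
  rw [((hL n hn1).offDiag j hj hj').measure_eq hS, chiMeasure_prod_apply hp0 hq0 hS]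
  -- A bad product forces one of its two chi-squared factors to be bad; each contributes two tails,
  -- hence the constant 4.
  have hsub : {z : ℝ × ℝ | √z.1 * √z.2 / n ∈
      {x : ℝ | ε ≤ |x - β * √((γ - j / n) * (1 - j / n))|}} ⊆
      {x | δ / 2 * n ≤ |x - p|} ×ˢ Set.univ ∪ Set.univ ×ˢ {y | δ / 2 * n ≤ |y - q|} := by
    intro z hz
    by_contra hcon
    simp only [Set.mem_union, Set.mem_prod, Set.mem_ofPred_eq, Set.mem_univ, and_true, true_and,
      not_or, not_le] at hcon hz
    have hu1 : (j : ℝ) / n ≤ 1 := by rw [div_le_one hn0]; linarith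
    have hu0 : 0 ≤ (j : ℝ) / n := by positivity
    have hx : |z.1 - β * (γ - j / n) * n| < δ * n := by
      have e : z.1 - β * (γ - j / n) * n = (z.1 - p) - β * (γ - 1) := by
        rw [hpdef]
        field_simp
        ring
      have h2 := abs_sub (z.1 - p) (β * (γ - 1))
      rw [abs_of_nonneg (show 0 ≤ β * (γ - 1) from mul_nonneg hβ.le (by linarith))] at h2
      rw [e]
      nlinarith [hcon.1]
    have hy : |z.2 - β * (1 - j / n) * n| < δ * n := by
      have e : β * (1 - j / n) * n = q := by
        rw [hqdef]
        field_simp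
      rw [e]
      have : 0 < δ * n := by positivity
      linarith [hcon.2]
    have h3 := abs_sqrt_mul_sqrt_div_sub_le (K := K) hn0 hδ1
      (by nlinarith) (by nlinarith) hx hy
    rw [← Real.sqrt_mul (mul_nonneg hβ.le (by linarith)),
      show β * (γ - j / n) * (β * (1 - j / n)) = β ^ 2 * ((γ - j / n) * (1 - j / n)) by ring,
      Real.sqrt_mul (sq_nonneg β), Real.sqrt_sq hβ.le] at h3
    linarith
  refine (measure_mono hsub).trans ((measure_union_le _ _).trans ?_)
  rw [Measure.prod_prod, Measure.prod_prod, measure_univ, measure_univ, mul_one, one_mul,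
    show (4 : ℝ) * Real.exp (-c * n) = 2 * Real.exp (-c * n) + 2 * Real.exp (-c * n) by ring,
    ENNReal.ofReal_add (by positivity) (by positivity)]
  exact add_le_add (hb n p hp0 hpK) (hb n q hq0 hqK)

/-- Almost surely the entries are uniformly close to their limiting profiles. -/
theorem ae_forall_eventually_entries_close (hβ : 0 < β) (hγ : 1 ≤ γ)
    (hL : ∀ n, 1 ≤ n → IsLaguerreEntries β γ n P (a n) (b n)) :
    ∀ᵐ ω ∂P, ∀ ε : ℝ, 0 < ε → ∀ᶠ n : ℕ in atTop, ∀ j : ℕ, 1 ≤ j → j ≤ n - 1 →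
      |a n j ω - β * (γ + 1 - 2 * (j / n))| < ε ∧
        |b n j ω - β * √((γ - j / n) * (1 - j / n))| < ε := by
  -- The exceptional null set depends on ε, so only the countably many values 1/(m+1) are used.
  have h := ae_all_iff.2 fun m : ℕ => (ae_eventually_diag_close hβ hγ hL
    (show (0 : ℝ) < 1 / (m + 1) by positivity)).and (ae_eventually_offDiag_close hβ hγ hL
    (show (0 : ℝ) < 1 / (m + 1) by positivity))
  filter_upwards [h] with ω hω ε hε
  obtain ⟨m, hm⟩ := exists_nat_one_div_lt hε
  filter_upwards [(hω m).1, (hω m).2] with n h1 h2 j hj hj'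
  exact ⟨(h1 j hj hj').trans hm, (h2 j hj hj').trans hm⟩

end Laguerre

/-! ### Coupling the uniform roots and passing to the local limit. -/

/-- The vertex `⌊(n + 1) u⌋` of the path on `n + 1` vertices. -/
noncomputable def floorVertex (n : ℕ) (u : unitInterval) : Fin (n + 1) :=
  ⟨min ⌊(n + 1 : ℝ) * u⌋₊ n, by omega⟩

theorem measurable_floorVertex (n : ℕ) : Measurable (floorVertex n) := by
  have h : Measurable fun u : unitInterval => min ⌊(n + 1 : ℝ) * u⌋₊ n := by fun_prop
  refine measurable_to_countable' fun i => ?_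
  have : floorVertex n ⁻¹' {i} = (fun u : unitInterval => min ⌊(n + 1 : ℝ) * u⌋₊ n) ⁻¹' {(i : ℕ)} := by
    ext u
    simp [floorVertex, Fin.ext_iff]
  rw [this]
  exact h (measurableSet_singleton _)

theorem ae_unitInterval_mem_Ioo : ∀ᵐ u : unitInterval, (u : ℝ) ∈ Set.Ioo (0 : ℝ) 1 := by
  have h0 : ∀ᵐ u : unitInterval, u ≠ 0 := compl_mem_ae_iff.2 (measure_singleton _)
  have h1 : ∀ᵐ u : unitInterval, u ≠ 1 := compl_mem_ae_iff.2 (measure_singleton _)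
  filter_upwards [h0, h1] with u hu0 hu1
  exact ⟨lt_of_le_of_ne u.2.1 fun h => hu0 (Subtype.ext h.symm),
    lt_of_le_of_ne u.2.2 fun h => hu1 (Subtype.ext h)⟩

theorem floorVertex_of_lt_one {n : ℕ} {u : unitInterval} (hu : (u : ℝ) < 1) :
    (floorVertex n u : ℕ) = ⌊(n + 1 : ℝ) * u⌋₊ := by
  have h : ⌊(n + 1 : ℝ) * u⌋₊ < n + 1 := by
    have h0 : (0 : ℝ) < n + 1 := by positivity
    rw [Nat.floor_lt (mul_nonneg h0.le u.2.1)]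
    push_cast
    nlinarith
  exact min_eq_left (by omega)

theorem map_floorVertex (n : ℕ) :
    (volume : Measure unitInterval).map (floorVertex n) = uniformRoot n := by
  have h0 : (0 : ℝ) < n + 1 := by positivity
  refine Measure.ext_of_singleton fun i => ?_
  rw [Measure.map_apply (measurable_floorVertex n) (measurableSet_singleton i), uniformRoot,
    PMF.toMeasure_apply_singleton _ _ (measurableSet_singleton i), PMF.uniformOfFintype_apply,
    Fintype.card_fin]
  -- The equality is only almost everywhere: at u = 1 the truncation sends u to the last vertex,
  -- while the half-open interval omits it.
  have hset : (floorVertex n ⁻¹' {i} : Set unitInterval) =ᵐ[volume]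
      ((↑) ⁻¹' Set.Ico ((i : ℝ) / (n + 1)) ((i + 1) / (n + 1)) : Set unitInterval) := by
    filter_upwards [ae_unitInterval_mem_Ioo] with u hu
    refine propext ?_
    change floorVertex n u = i ↔ (u : ℝ) ∈ Set.Ico ((i : ℝ) / (n + 1)) ((i + 1) / (n + 1))
    rw [Fin.ext_iff, floorVertex_of_lt_one hu.2, Nat.floor_eq_iff (mul_nonneg h0.le hu.1.le),
      Set.mem_Ico, div_le_iff₀ h0, lt_div_iff₀ h0, mul_comm]
  have hi : (i : ℝ) + 1 ≤ n + 1 := by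
    have := i.2
    exact_mod_cast (by omega : (i : ℕ) + 1 ≤ n + 1)
  have hsub : Set.Ico ((i : ℝ) / (n + 1)) ((i + 1) / (n + 1)) ⊆ unitInterval := fun x hx =>
    ⟨le_trans (by positivity) hx.1, hx.2.le.trans ((div_le_one h0).2 hi)⟩
  rw [measure_congr hset, unitInterval.measurePreserving_coe.measure_preimage
    measurableSet_Ico.nullMeasurableSet, Measure.restrict_apply measurableSet_Ico,
    Set.inter_eq_left.2 hsub, Real.volume_Ico, ← sub_div, add_sub_cancel_left,
    one_div, ENNReal.ofReal_inv_of_pos h0]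
  congr 1
  rw [ENNReal.ofReal_add (by positivity) zero_le_one]
  simp

/-- Local convergence around the vertex `⌊(n + 1) u⌋`, for entries uniformly close to continuous
profiles. -/
theorem tendsto_mk_tridiagGraph_floorVertex {a b : ℕ → ℕ → ℝ} {f g : ℝ → ℝ}
    (h : ∀ ε : ℝ, 0 < ε → ∀ᶠ n : ℕ in atTop, ∀ j : ℕ, 1 ≤ j → j ≤ n - 1 →
      |a n j - f (j / n)| < ε ∧ |b n j - g (j / n)| < ε)
    {u : unitInterval} (hu : (u : ℝ) ∈ Set.Ioo (0 : ℝ) 1) (hf : ContinuousAt f u)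
    (hg : ContinuousAt g u) :
    Tendsto (fun n => RootedGraphClass.mk
      (tridiagGraph n (a (n + 1)) (b (n + 1)) (floorVertex n u))) atTop
      (𝓝 (RootedGraphClass.mk (intGraph (f u) (g u)))) := by
  refine RootedGraphClass.tendsto_mk fun r ε hε => ?_
  obtain ⟨η, hη, hη'⟩ := Metric.eventually_nhds_iff.1
    ((hf.eventually (Metric.ball_mem_nhds _ (half_pos hε))).and
      (hg.eventually (Metric.ball_mem_nhds _ (half_pos hε))))
  have hcast : Tendsto (fun n : ℕ => (n : ℝ) + 1) atTop atTop :=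
    tendsto_atTop_add_const_right _ _ tendsto_natCast_atTop_atTop
  have hu1 : 0 < 1 - (u : ℝ) := by linarith [hu.2]
  -- The root is within 1 of (n+1)u and the ball adds r, so the first two bounds on r + 2 keep the
  -- ball inside the path and the third puts every j/(n+1) within η of u.
  filter_upwards [(tendsto_add_atTop_nat 1).eventually (h (ε / 2) (half_pos hε)),
    (hcast.const_mul_atTop hu.1).eventually_ge_atTop ((r : ℝ) + 2),
    (hcast.const_mul_atTop hu1).eventually_ge_atTop ((r : ℝ) + 2),
    (hcast.const_mul_atTop hη).eventually_gt_atTop ((r : ℝ) + 1)] with n hn h1 h2 h3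
  have h0 : (0 : ℝ) < n + 1 := by positivity
  set o := floorVertex n u with ho
  have hofl : (o : ℕ) = ⌊(n + 1 : ℝ) * u⌋₊ := floorVertex_of_lt_one hu.2
  have ho1 : ((o : ℕ) : ℝ) ≤ (n + 1 : ℝ) * u := by
    rw [hofl]
    exact Nat.floor_le (mul_nonneg h0.le hu.1.le)
  have ho2 : (n + 1 : ℝ) * u < ((o : ℕ) : ℝ) + 1 := by
    rw [hofl]
    exact Nat.lt_floor_add_one _
  -- The extra 1 keeps index 0 out of the ball. This matters: the entry `a 0` has mean near βγ,
  -- whereas the profile at 0 is β(γ+1).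
  have ho3 : r + 1 ≤ (o : ℕ) := by
    have : ((r + 1 : ℕ) : ℝ) < ((o + 1 : ℕ) : ℝ) := by
      push_cast
      linarith
    have := Nat.cast_lt.1 this
    omega
  have ho4 : (o : ℕ) + r ≤ n := by
    have : (((o : ℕ) + r : ℕ) : ℝ) ≤ (n : ℝ) := by
      push_cast
      linarith
    exact_mod_cast this
  refine RootedWeightedGraph.locallyClose_intGraph_tridiagGraph hε (by omega) ho4
    fun j hj1 hj2 => ?_
  have hjn := hn j (by omega) (by omega)
  have hj1' : (o : ℝ) ≤ j + r := by exact_mod_cast hj1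
  have hj2' : (j : ℝ) ≤ o + r := by exact_mod_cast hj2
  have hclose : dist ((j : ℝ) / ((n + 1 : ℕ) : ℝ)) u < η := by
    rw [Real.dist_eq, Nat.cast_add_one,
      show (j : ℝ) / (n + 1) - u = (j - (n + 1) * u) / (n + 1) by field_simp,
      abs_div, abs_of_pos h0, div_lt_iff₀ h0, abs_lt]
    constructor <;> linarith
  obtain ⟨hf', hg'⟩ := hη' hclose
  rw [Real.dist_eq] at hf' hg'
  have e1 := abs_sub_le (a (n + 1) j) (f (j / ((n + 1 : ℕ) : ℝ))) (f u)
  have e2 := abs_sub_le (b (n + 1) j) (g (j / ((n + 1 : ℕ) : ℝ))) (g u)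
  constructor <;> linarith

/-- Convergence in distribution sees only the laws, so a limit proved under the coupling by u
carries over to the original random roots. -/
theorem MeasureTheory.TendstoInDistribution.of_map_eq {ι E Ω' Ω₂' : Type*} {Ω Ω₂ : ι → Type*}
    [∀ i, MeasurableSpace (Ω i)] [∀ i, MeasurableSpace (Ω₂ i)] [MeasurableSpace Ω']
    [MeasurableSpace Ω₂'] [MeasurableSpace E] [TopologicalSpace E] [OpensMeasurableSpace E]
    {μ : (i : ι) → Measure (Ω i)} [∀ i, IsProbabilityMeasure (μ i)]
    {ν : (i : ι) → Measure (Ω₂ i)} [∀ i, IsProbabilityMeasure (ν i)]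
    {μ' : Measure Ω'} [IsProbabilityMeasure μ'] {ν' : Measure Ω₂'} [IsProbabilityMeasure ν']
    {X : (i : ι) → Ω i → E} {Y : (i : ι) → Ω₂ i → E} {Z : Ω' → E} {W : Ω₂' → E} {l : Filter ι}
    (h : TendstoInDistribution X l Z μ μ') (hY : ∀ i, AEMeasurable (Y i) (ν i))
    (hW : AEMeasurable W ν') (hXY : ∀ i, (μ i).map (X i) = (ν i).map (Y i))
    (hZW : μ'.map Z = ν'.map W) : TendstoInDistribution Y l W ν ν' where
  forall_aemeasurable := hY
  aemeasurable_limit := hW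
  tendsto := by
    have h1 := h.tendsto
    have e1 : ∀ i, (⟨(μ i).map (X i), Measure.isProbabilityMeasure_map
        (h.forall_aemeasurable i)⟩ : ProbabilityMeasure E) =
        ⟨(ν i).map (Y i), Measure.isProbabilityMeasure_map (hY i)⟩ := fun i =>
      Subtype.ext (hXY i)
    have e2 : (⟨μ'.map Z, Measure.isProbabilityMeasure_map
        h.aemeasurable_limit⟩ : ProbabilityMeasure E) =
        ⟨ν'.map W, Measure.isProbabilityMeasure_map hW⟩ := Subtype.ext hZW
    rw [e2] at h1
    exact h1.congr e1

/-! ### Benjamini–Schramm convergence, for fixed and for random matrices. -/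

section Laguerre

variable {β γ : ℝ} {Ω : Type*} [MeasurableSpace Ω] {P : Measure Ω} {a b : ℕ → ℕ → Ω → ℝ}

theorem ae_forall_tendsto_mk_tridiagGraph (hβ : 0 < β) (hγ : 1 ≤ γ)
    (hL : ∀ n, 1 ≤ n → IsLaguerreEntries β γ n P (a n) (b n)) :
    ∀ᵐ ω ∂P, ∀ u : unitInterval, (u : ℝ) ∈ Set.Ioo (0 : ℝ) 1 →
      Tendsto (fun n => RootedGraphClass.mk (tridiagGraph n (fun j => a (n + 1) j ω)
        (fun j => b (n + 1) j ω) (floorVertex n u))) atTop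
        (𝓝 (RootedGraphClass.mk (laguerreLimitGraph β γ u))) := by
  filter_upwards [ae_forall_eventually_entries_close hβ hγ hL] with ω hω u hu
  exact tendsto_mk_tridiagGraph_floorVertex (a := fun n j => a n j ω) (b := fun n j => b n j ω)
    (f := fun x => β * (γ + 1 - 2 * x)) (g := fun x => β * √((γ - x) * (1 - x))) hω hu
    (by fun_prop) (by fun_prop)

theorem aemeasurable_diag (hL : ∀ n, 1 ≤ n → IsLaguerreEntries β γ n P (a n) (b n)) (n j : ℕ)
    (hj : j ≤ n) : AEMeasurable (a (n + 1) j) P := by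
  rcases Nat.eq_zero_or_pos j with rfl | hj0
  · exact (hL (n + 1) (by omega)).diag_zero.aemeasurable
  · exact ((hL (n + 1) (by omega)).diag j hj0 (by omega)).aemeasurable

theorem aemeasurable_offDiag (hL : ∀ n, 1 ≤ n → IsLaguerreEntries β γ n P (a n) (b n)) (n j : ℕ)
    (hj0 : 1 ≤ j) (hj : j ≤ n) : AEMeasurable (b (n + 1) j) P :=
  ((hL (n + 1) (by omega)).offDiag j hj0 (by omega)).aemeasurable

theorem ae_benjaminiSchrammConverges_laguerre (hβ : 0 < β) (hγ : 1 ≤ γ)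
    (hL : ∀ n, 1 ≤ n → IsLaguerreEntries β γ n P (a n) (b n)) :
    ∀ᵐ ω ∂P, BenjaminiSchrammConverges uniformRoot
      (fun n o => tridiagGraph n (fun j => a (n + 1) j ω) (fun j => b (n + 1) j ω) o)
      (volume : Measure unitInterval) (laguerreLimitGraph β γ) := by
  filter_upwards [ae_forall_tendsto_mk_tridiagGraph hβ hγ hL] with ω hω
  have hm : ∀ n, Measurable fun o : Fin (n + 1) => RootedGraphClass.mk
      (tridiagGraph n (fun j => a (n + 1) j ω) (fun j => b (n + 1) j ω) o) :=
    fun n => measurable_of_countable _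
  have hZ : AEMeasurable (fun u => RootedGraphClass.mk (laguerreLimitGraph β γ u))
      (volume : Measure unitInterval) :=
    (RootedGraphClass.continuous_mk_laguerreLimitGraph β γ).measurable.aemeasurable
  have h := tendstoInDistribution_of_ae_tendsto (l := atTop)
    (fun n => ((hm n).comp (measurable_floorVertex n)).aemeasurable) hZ
    (ae_unitInterval_mem_Ioo.mono fun u hu => hω u hu)
  refine h.of_map_eq (fun n => (hm n).aemeasurable) hZ (fun n => ?_) rfl
  rw [← Measure.map_map (hm n) (measurable_floorVertex n), map_floorVertex]

theorem benjaminiSchrammConverges_laguerre [IsProbabilityMeasure P] (hβ : 0 < β) (hγ : 1 ≤ γ)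
    (hL : ∀ n, 1 ≤ n → IsLaguerreEntries β γ n P (a n) (b n)) :
    BenjaminiSchrammConverges (fun n => P.prod (uniformRoot n))
      (fun n p => tridiagGraph n (fun j => a (n + 1) j p.1) (fun j => b (n + 1) j p.1) p.2)
      (volume : Measure unitInterval) (laguerreLimitGraph β γ) := by
  have hφ : ∀ n, MeasurePreserving (Prod.map id (floorVertex n))
      (P.prod (volume : Measure unitInterval)) (P.prod (uniformRoot n)) := fun n =>
    (MeasurePreserving.id P).prod ⟨measurable_floorVertex n, map_floorVertex n⟩
  have hm : ∀ n, AEMeasurable (fun p : Ω × Fin (n + 1) => RootedGraphClass.mk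
      (tridiagGraph n (fun j => a (n + 1) j p.1) (fun j => b (n + 1) j p.1) p.2))
      (P.prod (uniformRoot n)) := fun n => by
    have ho : ∀ o : Fin (n + 1), AEMeasurable (fun ω => RootedGraphClass.mk
        (tridiagGraph n (fun j => a (n + 1) j ω) (fun j => b (n + 1) j ω) o)) P := fun o =>
      RootedGraphClass.aemeasurable_mk_tridiagGraph (aemeasurable_diag hL n)
        (aemeasurable_offDiag hL n) o
    -- There are finitely many roots, so measurable versions chosen root by root glue to one on the
    -- product.
    refine ⟨fun p => (ho p.2).mk _ p.1,
      measurable_from_prod_countable_left fun o => (ho o).measurable_mk, ?_⟩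
    have h := ae_all_iff.2 fun o => (ho o).ae_eq_mk
    filter_upwards [Measure.quasiMeasurePreserving_fst.ae h] with p hp
    exact hp p.2
  have hZ : AEMeasurable (fun u => RootedGraphClass.mk (laguerreLimitGraph β γ u))
      (volume : Measure unitInterval) :=
    (RootedGraphClass.continuous_mk_laguerreLimitGraph β γ).measurable.aemeasurable
  have hsnd : MeasurePreserving Prod.snd (P.prod (volume : Measure unitInterval)) volume :=
    measurePreserving_snd
  have hlim : ∀ᵐ p ∂(P.prod (volume : Measure unitInterval)),
      Tendsto (fun n => RootedGraphClass.mk (tridiagGraph n (fun j => a (n + 1) j p.1)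
        (fun j => b (n + 1) j p.1) (floorVertex n p.2))) atTop
        (𝓝 (RootedGraphClass.mk (laguerreLimitGraph β γ p.2))) := by
    filter_upwards [Measure.quasiMeasurePreserving_fst.ae
      (ae_forall_tendsto_mk_tridiagGraph hβ hγ hL), hsnd.quasiMeasurePreserving.ae
      ae_unitInterval_mem_Ioo] with p hp hp'
    exact hp _ hp'
  have h := tendstoInDistribution_of_ae_tendsto (l := atTop)
    (fun n => (hm n).comp_quasiMeasurePreserving (hφ n).quasiMeasurePreserving)
    (hZ.comp_quasiMeasurePreserving hsnd.quasiMeasurePreserving) hlim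
  refine h.of_map_eq hm hZ (fun n => ?_) ?_
  · rw [← AEMeasurable.map_map_of_aemeasurable (by rw [(hφ n).map_eq]; exact hm n)
      (hφ n).measurable.aemeasurable, (hφ n).map_eq]
  · rw [← AEMeasurable.map_map_of_aemeasurable (by rw [hsnd.map_eq]; exact hZ)
      hsnd.measurable.aemeasurable, hsnd.map_eq]

end Laguerre

/-! ### Spectral resolution of a real multiplication operator. -/

section MulOperator

variable {α : Type*} [MeasurableSpace α] {μ : Measure α}

open Classical in
/-- The operator of multiplication by an essentially bounded function on `L²(μ)`. -/
noncomputable def mulOperator (μ : Measure α) (h : α → ℂ) : Lp ℂ 2 μ →L[ℂ] Lp ℂ 2 μ :=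
  if hh : MemLp h ⊤ μ then
    (ContinuousLinearMap.mul ℂ ℂ).holderL μ ⊤ 2 2 (hh.toLp h)
  else 0

theorem coeFn_mulOperator {h : α → ℂ} (hh : MemLp h ⊤ μ) (f : Lp ℂ 2 μ) :
    mulOperator μ h f =ᵐ[μ] fun x => h x * f x := by
  rw [mulOperator, dif_pos hh]
  filter_upwards [(ContinuousLinearMap.mul ℂ ℂ).coeFn_holder (r := 2) (hh.toLp h) f,
    hh.coeFn_toLp] with x hx hx'
  rw [ContinuousLinearMap.holderL_apply_apply, hx, hx']
  rfl

theorem mulOperator_mul {h k : α → ℂ} (hh : MemLp h ⊤ μ) (hk : MemLp k ⊤ μ) :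
    mulOperator μ h * mulOperator μ k = mulOperator μ (fun x => h x * k x) := by
  ext1 f
  refine Lp.ext ?_
  filter_upwards [coeFn_mulOperator hh (mulOperator μ k f), coeFn_mulOperator hk f,
    coeFn_mulOperator (h := fun x => h x * k x) (hk.mul hh) f] with x h1 h2 h3
  rw [mul_apply_eq_comp, h1, h2, h3, mul_assoc]

theorem mulOperator_add {h k : α → ℂ} (hh : MemLp h ⊤ μ) (hk : MemLp k ⊤ μ) :
    mulOperator μ (fun x => h x + k x) = mulOperator μ h + mulOperator μ k := by
  ext1 f
  refine Lp.ext ?_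
  filter_upwards [coeFn_mulOperator hh f, coeFn_mulOperator hk f,
    coeFn_mulOperator (h := fun x => h x + k x) (hh.add hk) f,
    Lp.coeFn_add (mulOperator μ h f) (mulOperator μ k f)] with x h1 h2 h3 h4
  rw [add_apply, h4, h3, Pi.add_apply, h1, h2, add_mul]

theorem inner_mulOperator_left {h : α → ℂ} (hh : MemLp h ⊤ μ) (f f' : Lp ℂ 2 μ) :
    inner ℂ (mulOperator μ h f) f' = ∫ x, f' x * starRingEnd ℂ (h x * f x) ∂μ := by
  rw [L2.inner_def]
  refine integral_congr_ae ?_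
  filter_upwards [coeFn_mulOperator hh f] with x hx
  rw [RCLike.inner_apply, hx]

theorem isSelfAdjoint_mulOperator {h : α → ℝ} (hh : MemLp (fun x => (h x : ℂ)) ⊤ μ) :
    IsSelfAdjoint (mulOperator μ fun x => (h x : ℂ)) := by
  rw [ContinuousLinearMap.isSelfAdjoint_iff_isSymmetric]
  intro f f'
  change inner ℂ (mulOperator μ _ f) f' = inner ℂ f (mulOperator μ _ f')
  rw [inner_mulOperator_left hh, L2.inner_def]
  refine integral_congr_ae ?_
  filter_upwards [coeFn_mulOperator hh f'] with x hx
  rw [RCLike.inner_apply, hx, map_mul, Complex.conj_ofReal]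
  ring

/-- Restriction to the set `S`, as an operator on `L²(μ)`. -/
noncomputable def restrictOperator (μ : Measure α) (S : Set α) : Lp ℂ 2 μ →L[ℂ] Lp ℂ 2 μ :=
  mulOperator μ fun x => ((S.indicator (fun _ => (1 : ℝ)) x : ℝ) : ℂ)

theorem memLp_top_ofReal_indicator {S : Set α} (hS : MeasurableSet S) :
    MemLp (fun x => ((S.indicator (fun _ => (1 : ℝ)) x : ℝ) : ℂ)) ⊤ μ := by
  have hm : Measurable fun x => ((S.indicator (fun _ => (1 : ℝ)) x : ℝ) : ℂ) :=
    Complex.measurable_ofReal.comp (measurable_const.indicator hS)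
  refine memLp_top_of_bound hm.aestronglyMeasurable 1 (ae_of_all _ fun x => ?_)
  by_cases hx : x ∈ S <;> simp [hx]

theorem restrictOperator_inter {S T : Set α} (hS : MeasurableSet S) (hT : MeasurableSet T) :
    restrictOperator μ (S ∩ T) = restrictOperator μ S * restrictOperator μ T := by
  rw [restrictOperator, restrictOperator, restrictOperator,
    mulOperator_mul (memLp_top_ofReal_indicator hS) (memLp_top_ofReal_indicator hT)]
  congr 1
  funext x
  by_cases h1 : x ∈ S <;> by_cases h2 : x ∈ T <;> simp [h1, h2]

theorem restrictOperator_union {S T : Set α} (hS : MeasurableSet S) (hT : MeasurableSet T)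
    (hST : Disjoint S T) :
    restrictOperator μ (S ∪ T) = restrictOperator μ S + restrictOperator μ T := by
  rw [restrictOperator, restrictOperator, restrictOperator,
    ← mulOperator_add (memLp_top_ofReal_indicator hS) (memLp_top_ofReal_indicator hT)]
  congr 1
  funext x
  rw [Set.indicator_union_of_disjoint hST]
  push_cast
  rfl

theorem restrictOperator_univ : restrictOperator μ Set.univ = 1 := by
  ext1 f
  refine Lp.ext ?_
  filter_upwards [coeFn_mulOperator (memLp_top_ofReal_indicator (μ := μ) MeasurableSet.univ) f]
    with x hx
  rw [restrictOperator, hx]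
  simp

theorem restrictOperator_empty : restrictOperator μ ∅ = 0 := by
  have h := restrictOperator_union (μ := μ) MeasurableSet.empty MeasurableSet.empty
    (Set.disjoint_empty _)
  simpa using h

theorem isStarProjection_restrictOperator {S : Set α} (hS : MeasurableSet S) :
    IsStarProjection (restrictOperator μ S) :=
  ⟨by rw [IsIdempotentElem, ← restrictOperator_inter hS hS, Set.inter_self],
    isSelfAdjoint_mulOperator (memLp_top_ofReal_indicator hS)⟩

theorem inner_restrictOperator_self {S : Set α} (hS : MeasurableSet S) (f : Lp ℂ 2 μ) :
    inner ℂ (restrictOperator μ S f) f = ((∫ x in S, ‖f x‖ ^ 2 ∂μ : ℝ) : ℂ) := by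
  rw [restrictOperator, inner_mulOperator_left (memLp_top_ofReal_indicator hS),
    ← integral_indicator hS, ← integral_complex_ofReal]
  refine integral_congr_ae (ae_of_all _ fun x => ?_)
  by_cases hx : x ∈ S
  · simp [hx, Complex.mul_conj, Complex.normSq_eq_norm_sq]
  · simp [hx]

theorem integrable_norm_sq_Lp (f : Lp ℂ 2 μ) : Integrable (fun x => ‖f x‖ ^ 2) μ :=
  (memLp_two_iff_integrable_sq_norm (Lp.aestronglyMeasurable f)).1 (Lp.memLp f)

theorem norm_restrictOperator_sq {S : Set α} (hS : MeasurableSet S) (f : Lp ℂ 2 μ) :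
    ‖restrictOperator μ S f‖ ^ 2 = ∫ x in S, ‖f x‖ ^ 2 ∂μ := by
  have hP := isStarProjection_restrictOperator (μ := μ) hS
  have h1 : inner ℂ (restrictOperator μ S f) (restrictOperator μ S f) =
      inner ℂ (restrictOperator μ S f) f := by
    have h2 := (ContinuousLinearMap.isSelfAdjoint_iff_isSymmetric.1 hP.isSelfAdjoint)
      (restrictOperator μ S f) f
    change inner ℂ (restrictOperator μ S (restrictOperator μ S f)) f =
      inner ℂ (restrictOperator μ S f) (restrictOperator μ S f) at h2
    rw [← h2, ← mul_apply_eq_comp, hP.isIdempotentElem.eq]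
  rw [inner_restrictOperator_self hS, inner_self_eq_norm_sq_to_K] at h1
  rw [← Complex.ofReal_inj, ← h1]
  push_cast
  rfl

theorem sum_restrictOperator {X : ℕ → Set α} (hX : ∀ i, MeasurableSet (X i))
    (hd : Pairwise (Function.onFun Disjoint X)) (s : Finset ℕ) :
    ∑ i ∈ s, restrictOperator μ (X i) = restrictOperator μ (⋃ i ∈ s, X i) := by
  induction s using Finset.induction_on with
  | empty => simp [restrictOperator_empty]
  | insert i s hi ih =>
    rw [Finset.sum_insert hi, ih, Finset.set_biUnion_insert, restrictOperator_union (hX i)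
      (s.measurableSet_biUnion fun j _ => hX j)]
    rw [Set.disjoint_iUnion₂_right]
    exact fun j hj => hd fun h => hi (h ▸ hj)

/-- The squared error of a partial sum is the integral of |f|² over the part of the union not yet
covered, so strong countable additivity reduces to that of the integral. -/
theorem hasSum_restrictOperator {X : ℕ → Set α} (hX : ∀ i, MeasurableSet (X i))
    (hd : Pairwise (Function.onFun Disjoint X)) (f : Lp ℂ 2 μ) :
    HasSum (fun i => restrictOperator μ (X i) f) (restrictOperator μ (⋃ i, X i) f) := by
  have hU : MeasurableSet (⋃ i, X i) := MeasurableSet.iUnion hX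
  have hsum := hasSum_integral_iUnion (f := fun x => ‖f x‖ ^ 2) hX hd
    (integrable_norm_sq_Lp f).integrableOn
  have key : ∀ s : Finset ℕ,
      ‖∑ i ∈ s, restrictOperator μ (X i) f - restrictOperator μ (⋃ i, X i) f‖ ^ 2 =
        ∫ x in ⋃ i, X i, ‖f x‖ ^ 2 ∂μ - ∑ i ∈ s, ∫ x in X i, ‖f x‖ ^ 2 ∂μ := fun s => by
    have hs : MeasurableSet (⋃ i ∈ s, X i) := s.measurableSet_biUnion fun j _ => hX j
    have hsub : (⋃ i ∈ s, X i) ⊆ ⋃ i, X i := Set.iUnion₂_subset_iUnion _ _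
    have h1 := restrictOperator_union (μ := μ) hs (hU.diff hs) Set.disjoint_sdiff_right
    rw [Set.union_sdiff_cancel hsub, ← sum_restrictOperator hX hd] at h1
    have h2 : ∑ i ∈ s, restrictOperator μ (X i) f - restrictOperator μ (⋃ i, X i) f =
        -restrictOperator μ ((⋃ i, X i) \ ⋃ i ∈ s, X i) f := by
      rw [h1, add_apply, sum_apply]
      abel
    rw [h2, norm_neg, norm_restrictOperator_sq (hU.diff hs),
      setIntegral_sdiff hs (integrable_norm_sq_Lp f).integrableOn hsub,
      integral_biUnion_finset _ (fun i _ => hX i) (fun i _ j _ hij => hd hij)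
        fun i _ => (integrable_norm_sq_Lp f).integrableOn]
  rw [HasSum, tendsto_iff_norm_sub_tendsto_zero]
  have h0 : Tendsto (fun s : Finset ℕ =>
      ‖∑ i ∈ s, restrictOperator μ (X i) f - restrictOperator μ (⋃ i, X i) f‖ ^ 2)
      (SummationFilter.unconditional ℕ).filter (𝓝 0) := by
    simp_rw [key]
    have := hsum.const_sub (∫ x in ⋃ i, X i, ‖f x‖ ^ 2 ∂μ)
    rwa [sub_self] at this
  have h1 := h0.sqrt
  simpa [Real.sqrt_sq] using h1

/-- The spectral resolution of a bounded real multiplication operator. -/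
theorem isSpectralResolution_mulOperator {g : α → ℝ} (hg : Measurable g) {C : ℝ}
    (hC : ∀ x, |g x| ≤ C) :
    IsSpectralResolution (mulOperator μ fun x => (g x : ℂ))
      (fun X => restrictOperator μ (g ⁻¹' X)) where
  isStarProjection X hX := isStarProjection_restrictOperator (hg hX)
  univ := restrictOperator_univ
  inter X Y hX hY := restrictOperator_inter (hg hX) (hg hY)
  iUnion X hX hd f := by
    rw [Set.preimage_iUnion]
    exact hasSum_restrictOperator (fun i => hg (hX i)) (fun i j hij => (hd hij).preimage g) f
  integral f := by
    have hgm : MemLp (fun x => (g x : ℂ)) ⊤ μ :=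
      memLp_top_of_bound (Complex.measurable_ofReal.comp hg).aestronglyMeasurable C
        (ae_of_all _ fun x => by simpa using hC x)
    have hf : Measurable fun x => ENNReal.ofReal (‖f x‖ ^ 2) := by
      have := (Lp.stronglyMeasurable f).measurable
      fun_prop
    have hfin : ∫⁻ x, ENNReal.ofReal (‖f x‖ ^ 2) ∂μ ≠ ⊤ := by
      rw [← ofReal_integral_eq_lintegral_ofReal (integrable_norm_sq_Lp f)
        (ae_of_all _ fun x => sq_nonneg _)]
      exact ENNReal.ofReal_ne_top
    have : IsFiniteMeasure (μ.withDensity fun x => ENNReal.ofReal (‖f x‖ ^ 2)) :=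
      isFiniteMeasure_withDensity hfin
    -- The scalar spectral measure of f is the image under g of the measure |f|² dμ.
    refine ⟨(μ.withDensity fun x => ENNReal.ofReal (‖f x‖ ^ 2)).map g, fun X hX => ?_, ?_, ?_⟩
    · rw [Measure.map_apply hg hX, withDensity_apply _ (hg hX), inner_restrictOperator_self (hg hX),
        Complex.ofReal_re, ofReal_integral_eq_lintegral_ofReal
          (integrable_norm_sq_Lp f).integrableOn (ae_of_all _ fun x => sq_nonneg _)]
    · rw [integrable_map_measure (by fun_prop) hg.aemeasurable]
      exact Integrable.of_bound hg.aestronglyMeasurable C (ae_of_all _ hC)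
    · rw [integral_map hg.aemeasurable (by fun_prop),
        integral_withDensity_eq_integral_toReal_smul hf (ae_of_all _ fun x =>
          ENNReal.ofReal_lt_top), inner_mulOperator_left hgm, ← integral_complex_ofReal]
      refine integral_congr_ae (ae_of_all _ fun x => ?_)
      dsimp only
      rw [ENNReal.toReal_ofReal (sq_nonneg _), smul_eq_mul, map_mul, Complex.conj_ofReal,
        mul_left_comm, Complex.mul_conj, Complex.normSq_eq_norm_sq]
      push_cast
      ring

end MulOperator

theorem LinearIsometryEquiv.inner_conjStarAlgEquiv {E F : Type*} [NormedAddCommGroup E]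
    [InnerProductSpace ℂ E] [CompleteSpace E] [NormedAddCommGroup F] [InnerProductSpace ℂ F]
    [CompleteSpace F] (e : E ≃ₗᵢ[ℂ] F) (B : E →L[ℂ] E) (f : F) :
    inner ℂ (e.conjStarAlgEquiv B f) f = inner ℂ (B (e.symm f)) (e.symm f) := by
  rw [e.conjStarAlgEquiv_apply_apply, ← e.inner_map_map, e.apply_symm_apply]

/-- Used to carry the resolution from L² of the circle to ℓ²(ℤ) by the Fourier isometry. -/
theorem IsSpectralResolution.conj {E F : Type*} [NormedAddCommGroup E] [InnerProductSpace ℂ E]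
    [CompleteSpace E] [NormedAddCommGroup F] [InnerProductSpace ℂ F] [CompleteSpace F]
    (e : E ≃ₗᵢ[ℂ] F) {A : E →L[ℂ] E} {P : Set ℝ → E →L[ℂ] E} (h : IsSpectralResolution A P) :
    IsSpectralResolution (e.conjStarAlgEquiv A) (fun X => e.conjStarAlgEquiv (P X)) where
  isStarProjection X hX := (h.isStarProjection X hX).map e.conjStarAlgEquiv
  univ := by rw [h.univ, map_one]
  inter X Y hX hY := by rw [h.inter X Y hX hY, map_mul]
  iUnion X hX hd f := (h.iUnion X hX hd (e.symm f)).mapL (e.toContinuousLinearEquiv : E →L[ℂ] F)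
  integral f := by
    obtain ⟨μ, h1, h2, h3⟩ := h.integral (e.symm f)
    exact ⟨μ, fun X hX => by rw [e.inner_conjStarAlgEquiv, h1 X hX], h2, by rw [e.inner_conjStarAlgEquiv, h3]⟩

/-! ### The adjacency operator of ℤ diagonalized by Fourier series. -/

section IntGraph

/-- The symbol `c + 2 d cos (2π x)` of the adjacency operator of `intGraph c d`. -/
noncomputable def intSymbol (c d : ℝ) (x : UnitAddCircle) : ℝ :=
  c + 2 * d * (AddCircle.toCircle x : ℂ).re

theorem continuous_intSymbol : Continuous fun p : (ℝ × ℝ) × UnitAddCircle =>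
    intSymbol p.1.1 p.1.2 p.2 := by
  have h : Continuous fun x : UnitAddCircle => (AddCircle.toCircle x : ℂ).re :=
    Complex.continuous_re.comp (continuous_subtype_val.comp AddCircle.continuous_toCircle)
  unfold intSymbol
  fun_prop

theorem measurable_intSymbol (c d : ℝ) : Measurable (intSymbol c d) :=
  (continuous_intSymbol.comp (Continuous.prodMk_right (c, d))).measurable

theorem abs_intSymbol_le (c d : ℝ) (x : UnitAddCircle) : |intSymbol c d x| ≤ |c| + 2 * |d| := by
  have h : |(AddCircle.toCircle x : ℂ).re| ≤ 1 :=
    (Complex.abs_re_le_norm _).trans (Circle.norm_coe _).le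
  refine (abs_add_le _ _).trans ?_
  rw [abs_mul, abs_mul, abs_two]
  have : 0 ≤ 2 * |d| := by positivity
  nlinarith

theorem ofReal_intSymbol (c d : ℝ) (x : UnitAddCircle) :
    (intSymbol c d x : ℂ) = c + d * (fourier 1 x + fourier (-1) x) := by
  rw [fourier_neg, fourier_one, Complex.add_conj, intSymbol]
  push_cast
  ring

theorem fourierCoeff_fourier_mul (k n : ℤ) (f : UnitAddCircle → ℂ) :
    fourierCoeff (fun x => fourier k x * f x) n = fourierCoeff f (n - k) := by
  refine integral_congr_ae (ae_of_all _ fun x => ?_)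
  simp only [smul_eq_mul]
  rw [← mul_assoc, ← fourier_add, show -n + k = -(n - k) by ring]

/-- Multiplication by the characters of index 1 and -1 shifts Fourier coefficients, so the adjacency
operator is conjugate to multiplication by the symbol. The root vector corresponds to the constant
1, whose scalar spectral measure is the law of the symbol under Haar measure. -/
theorem isRootSpectralMeasure_intGraph (c d : ℝ) :
    IsRootSpectralMeasure (intGraph c d)
      ((AddCircle.haarAddCircle : Measure UnitAddCircle).map (intSymbol c d)) := by
  let e : Lp ℂ 2 (AddCircle.haarAddCircle : Measure UnitAddCircle) ≃ₗᵢ[ℂ]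
    lp (fun _ : ℤ => ℂ) 2 := fourierBasis.repr
  have hm := measurable_intSymbol c d
  have hgm : MemLp (fun x => (intSymbol c d x : ℂ)) ⊤ AddCircle.haarAddCircle :=
    memLp_top_of_bound (Complex.measurable_ofReal.comp hm).aestronglyMeasurable (|c| + 2 * |d|)
      (ae_of_all _ fun x => by simpa using abs_intSymbol_le c d x)
  refine ⟨e.conjStarAlgEquiv (mulOperator _ fun x => (intSymbol c d x : ℂ)),
    fun X => e.conjStarAlgEquiv (restrictOperator _ (intSymbol c d ⁻¹' X)), ?_,
    (isSpectralResolution_mulOperator hm (abs_intSymbol_le c d)).conj e, fun X hX => ?_⟩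
  · intro (f : lp (fun _ : ℤ => ℂ) 2) (v : ℤ)
    change e (mulOperator _ (fun x => (intSymbol c d x : ℂ)) (e.symm f)) v =
      ∑ᶠ u : ℤ, (((if v = u then c else if v + 1 = u ∨ u + 1 = v then d else 0 : ℝ)) : ℂ) * f u
    set F := e.symm f with hF
    have hf : ∀ n, f n = fourierCoeff F n := fun n => by
      rw [← fourierBasis_repr, hF]
      exact congrArg (fun h : lp (fun _ : ℤ => ℂ) 2 => h n) (e.apply_symm_apply f).symm
    have hFi : Integrable F AddCircle.haarAddCircle :=
      (Lp.memLp F).integrable one_le_two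
    have hi : ∀ (k : ℤ), Integrable (fun x => fourier k x * F x) AddCircle.haarAddCircle :=
      fun k => by
        have := hFi.fourier_smul k
        simpa using this
    have h1 : e (mulOperator _ (fun x => (intSymbol c d x : ℂ)) F) v =
        c * f v + d * (f (v - 1) + f (v + 1)) := by
      change fourierBasis.repr _ v = _
      rw [fourierBasis_repr, fourierCoeff_congr_ae (coeFn_mulOperator hgm F)]
      have h2 : (fun x => (intSymbol c d x : ℂ) * F x) = fun x => (c : ℂ) * F x +
          (d : ℂ) * (fourier 1 x * F x + fourier (-1) x * F x) := by
        funext x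
        rw [ofReal_intSymbol]
        ring
      rw [h2]
      have h3 := fourierCoeff.add (hFi.const_mul (c : ℂ))
        (((hi 1).add (hi (-1))).const_mul (d : ℂ))
      have h4 := fourierCoeff.add (hi 1) (hi (-1))
      have h5 := congrFun h3 v
      simp only [Pi.add_def] at h5 h4
      rw [h5, fourierCoeff.const_mul, fourierCoeff.const_mul, congrFun h4 v,
        fourierCoeff_fourier_mul, fourierCoeff_fourier_mul, hf, hf, hf, sub_neg_eq_add]
    rw [h1, finsum_eq_sum_of_support_subset (s := {v - 1, v, v + 1})]
    · rw [Finset.sum_insert (by simp; omega), Finset.sum_pair (by omega), if_neg (by omega),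
        if_pos (by omega), if_pos rfl, if_neg (by omega), if_pos (by omega)]
      ring
    · intro u hu
      simp only [Function.mem_support] at hu
      simp only [Finset.coe_insert, Finset.coe_singleton, Set.mem_insert_iff,
        Set.mem_singleton_iff]
      by_contra hcon
      apply hu
      rw [if_neg (by omega), if_neg (by omega)]
      simp
  · have h0 : ∀ [DecidableEq ℤ], e.symm (lp.single 2 (0 : ℤ) (1 : ℂ)) = fourierLp 2 0 := by
      intro _
      rw [← coe_fourierBasis]
      exact fourierBasis.repr_symm_single 0
    suffices h : ∀ δ : lp (fun _ : ℤ => ℂ) 2, e.symm δ = fourierLp 2 0 →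
        (AddCircle.haarAddCircle : Measure UnitAddCircle).map (intSymbol c d) X = ENNReal.ofReal
          (inner ℂ (e.conjStarAlgEquiv (restrictOperator _ (intSymbol c d ⁻¹' X)) δ) δ).re from
      h _ (@h0 fun a b => Classical.propDecidable (a = b))
    intro δ hδ
    rw [Measure.map_apply hm hX, e.inner_conjStarAlgEquiv, hδ, inner_restrictOperator_self (hm hX), Complex.ofReal_re]
    have h1 : ∫ x in intSymbol c d ⁻¹' X, ‖(fourierLp 2 0 : Lp ℂ 2 AddCircle.haarAddCircle) x‖ ^ 2
        ∂(AddCircle.haarAddCircle : Measure UnitAddCircle) =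
        ∫ x in intSymbol c d ⁻¹' X, (1 : ℝ) ∂(AddCircle.haarAddCircle : Measure UnitAddCircle) := by
      refine integral_congr_ae (ae_restrict_of_ae ?_)
      filter_upwards [coeFn_fourierLp (T := (1 : ℝ)) 2 0] with x hx
      rw [hx, fourier_zero]
      simp
    rw [h1, setIntegral_const, smul_eq_mul, mul_one, Measure.real, ENNReal.ofReal_toReal
      (measure_ne_top _ _)]

end IntGraph

/-! ### The arcsine law and the integral over the mixing parameter. -/

theorem setLIntegral_eq_of_subset_of_forall_sdiff_eq_zero {α : Type*} [MeasurableSpace α]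
    {μ : Measure α} {f : α → ENNReal} {s t : Set α} (hs : MeasurableSet s) (ht : MeasurableSet t)
    (hst : s ⊆ t) (h : ∀ x ∈ t \ s, f x = 0) : ∫⁻ x in t, f x ∂μ = ∫⁻ x in s, f x ∂μ := by
  rw [← lintegral_indicator hs, ← lintegral_indicator ht]
  refine lintegral_congr fun x => ?_
  by_cases h1 : x ∈ s
  · rw [Set.indicator_of_mem h1, Set.indicator_of_mem (hst h1)]
  · by_cases h2 : x ∈ t
    · rw [Set.indicator_of_notMem h1, Set.indicator_of_mem h2, h x ⟨h2, h1⟩]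
    · rw [Set.indicator_of_notMem h1, Set.indicator_of_notMem h2]

theorem AddCircle.haarAddCircle_eq_volume :
    (AddCircle.haarAddCircle : Measure UnitAddCircle) = volume := by
  have h := AddCircle.volume_eq_smul_haarAddCircle (T := 1)
  rw [ENNReal.ofReal_one, one_smul] at h
  exact h.symm

theorem intSymbol_coe (c d θ : ℝ) :
    intSymbol c d (θ : UnitAddCircle) = c + 2 * d * Real.cos (2 * Real.pi * θ) := by
  have h : (AddCircle.toCircle (θ : UnitAddCircle) : ℂ).re = Real.cos (2 * Real.pi * θ) := by
    rw [AddCircle.toCircle_apply_mk, Circle.coe_exp, Complex.exp_ofReal_mul_I_re, div_one]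
  rw [intSymbol, h]

theorem image_cos_Ioo {c d : ℝ} (hd : 0 < d) :
    (fun θ => c + 2 * d * Real.cos (2 * Real.pi * θ)) '' Set.Ioo 0 (1 / 2) =
      Set.Ioo (c - 2 * d) (c + 2 * d) := by
  have hπ := Real.pi_pos
  ext x
  constructor
  · rintro ⟨θ, ⟨h0, h1⟩, rfl⟩
    have h2 : Real.cos (2 * Real.pi * θ) < 1 := by
      rw [← Real.cos_zero]
      exact Real.cos_lt_cos_of_nonneg_of_le_pi le_rfl (by nlinarith) (by positivity)
    have h3 : -1 < Real.cos (2 * Real.pi * θ) := by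
      rw [← Real.cos_pi]
      exact Real.cos_lt_cos_of_nonneg_of_le_pi (by positivity) le_rfl (by nlinarith)
    constructor <;> dsimp only <;> nlinarith
  · rintro ⟨h1, h2⟩
    have h3 : -1 < (x - c) / (2 * d) := by
      rw [lt_div_iff₀ (by positivity)]
      linarith
    have h4 : (x - c) / (2 * d) < 1 := by
      rw [div_lt_iff₀ (by positivity)]
      linarith
    refine ⟨Real.arccos ((x - c) / (2 * d)) / (2 * Real.pi), ⟨?_, ?_⟩, ?_⟩
    · exact div_pos (Real.arccos_pos.2 h4) (by positivity)
    · rw [div_lt_iff₀ (by positivity)]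
      have := Real.arccos_lt_pi.2 h3
      linarith
    · dsimp only
      rw [mul_div_cancel₀ _ (by positivity), Real.cos_arccos h3.le h4.le]
      field_simp
      ring

/-- The spectral measure at the root of `intGraph c d` is the arcsine law on `[c - 2d, c + 2d]`. -/
theorem map_intSymbol_apply {c d : ℝ} (hd : 0 < d) {X : Set ℝ} (hX : MeasurableSet X) :
    (AddCircle.haarAddCircle : Measure UnitAddCircle).map (intSymbol c d) X =
      ∫⁻ x in X, ENNReal.ofReal (1 / (Real.pi * √(4 * d ^ 2 - (x - c) ^ 2))) := by
  have hπ := Real.pi_pos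
  set φ : ℝ → ENNReal := X.indicator 1 with hφ
  set f : ℝ → ℝ := fun θ => c + 2 * d * Real.cos (2 * Real.pi * θ) with hf
  have hφm : Measurable φ := measurable_one.indicator hX
  have hfm : Measurable f := by fun_prop
  have h1 : (AddCircle.haarAddCircle : Measure UnitAddCircle).map (intSymbol c d) X =
      ∫⁻ θ in Set.Ioc (-(1 / 2) : ℝ) (-(1 / 2) + 1), φ (f θ) := by
    rw [Measure.map_apply (measurable_intSymbol c d) hX, AddCircle.haarAddCircle_eq_volume,
      ← lintegral_indicator_one (measurable_intSymbol c d hX), ← AddCircle.lintegral_preimage]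
    refine lintegral_congr fun θ => ?_
    rw [hφ, hf]
    dsimp only
    rw [← intSymbol_coe]
    rfl
  -- The cosine is even; folding onto (0, 1/2) makes the symbol injective, at the price of a factor
  -- 2.
  have h2 : ∫⁻ θ in Set.Ioc (-(1 / 2) : ℝ) (-(1 / 2) + 1), φ (f θ) =
      2 * ∫⁻ θ in Set.Ioo (0 : ℝ) (1 / 2), φ (f θ) := by
    have e1 : Set.Ioc (-(1 / 2) : ℝ) (-(1 / 2) + 1) = Set.Ioc (-(1 / 2)) 0 ∪ Set.Ioc 0 (1 / 2) := by
      rw [Set.Ioc_union_Ioc_eq_Ioc (by norm_num) (by norm_num)]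
      norm_num
    have e2 : ∫⁻ θ in Set.Ioc (-(1 / 2) : ℝ) 0, φ (f θ) =
        ∫⁻ θ in Set.Ioo (0 : ℝ) (1 / 2), φ (f θ) := by
      have e3 := (Measure.measurePreserving_neg (volume : Measure ℝ)).setLIntegral_comp_preimage_emb
        (MeasurableEquiv.neg ℝ).measurableEmbedding (fun θ => φ (f θ)) (Set.Ioo (-(1 / 2) : ℝ) 0)
      rw [← setLIntegral_congr (Ioo_ae_eq_Ioc (μ := (volume : Measure ℝ))), ← e3]
      have e4 : (Neg.neg ⁻¹' Set.Ioo (-(1 / 2) : ℝ) 0) = Set.Ioo 0 (1 / 2) := by simp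
      rw [e4]
      refine lintegral_congr fun θ => ?_
      simp only [hf, mul_neg, Real.cos_neg]
    rw [e1, lintegral_union measurableSet_Ioc (Set.Ioc_disjoint_Ioc_of_le le_rfl), e2,
      ← setLIntegral_congr (Ioo_ae_eq_Ioc (μ := (volume : Measure ℝ)) (a := 0)), two_mul]
  have hderiv : ∀ θ ∈ Set.Ioo (0 : ℝ) (1 / 2),
      HasDerivWithinAt f (-(4 * Real.pi * d * Real.sin (2 * Real.pi * θ))) (Set.Ioo 0 (1 / 2)) θ := by
    intro θ _
    refine HasDerivAt.hasDerivWithinAt ?_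
    refine ((((hasDerivAt_id' θ).const_mul (2 * Real.pi)).cos.const_mul (2 * d)).const_add
      c).congr_deriv ?_
    ring
  have hinj : Set.InjOn f (Set.Ioo (0 : ℝ) (1 / 2)) := by
    intro x hx y hy hxy
    have h : Real.cos (2 * Real.pi * x) = Real.cos (2 * Real.pi * y) := by
      have : 2 * d * Real.cos (2 * Real.pi * x) = 2 * d * Real.cos (2 * Real.pi * y) :=
        add_left_cancel hxy
      exact mul_left_cancel₀ (by positivity) this
    have := Real.injOn_cos ⟨by have := hx.1; positivity, by nlinarith [hx.2]⟩
      ⟨by have := hy.1; positivity, by nlinarith [hy.2]⟩ h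
    exact mul_left_cancel₀ (by positivity) this
  -- The weight is 1/|f'|: indeed |f'| = 4πd sin(2πθ) = 2π√(4d² - (f-c)²).
  have h3 := lintegral_image_eq_lintegral_abs_deriv_mul measurableSet_Ioo hderiv hinj
    (fun x => φ x * ENNReal.ofReal (1 / (2 * Real.pi * √(4 * d ^ 2 - (x - c) ^ 2))))
  have h4 : ∫⁻ θ in Set.Ioo (0 : ℝ) (1 / 2),
      ENNReal.ofReal |-(4 * Real.pi * d * Real.sin (2 * Real.pi * θ))| * (φ (f θ) *
        ENNReal.ofReal (1 / (2 * Real.pi * √(4 * d ^ 2 - (f θ - c) ^ 2)))) =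
      ∫⁻ θ in Set.Ioo (0 : ℝ) (1 / 2), φ (f θ) := by
    refine setLIntegral_congr_fun measurableSet_Ioo fun θ hθ => ?_
    have hs : 0 < Real.sin (2 * Real.pi * θ) :=
      Real.sin_pos_of_pos_of_lt_pi (by have := hθ.1; positivity) (by nlinarith [hθ.2])
    have e : 4 * d ^ 2 - (f θ - c) ^ 2 = (2 * d * Real.sin (2 * Real.pi * θ)) ^ 2 := by
      simp only [hf]
      rw [add_sub_cancel_left, mul_pow, mul_pow, mul_pow, Real.sin_sq]
      ring
    rw [e, Real.sqrt_sq (by positivity), abs_neg, abs_of_pos (by positivity), mul_left_comm,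
      ← ENNReal.ofReal_mul (by positivity)]
    have e2 : 4 * Real.pi * d * Real.sin (2 * Real.pi * θ) *
        (1 / (2 * Real.pi * (2 * d * Real.sin (2 * Real.pi * θ)))) = 1 := by
      rw [mul_one_div, div_eq_one_iff_eq (by positivity)]
      ring
    rw [e2, ENNReal.ofReal_one, mul_one]
  rw [h1, h2, ← h4, ← h3, image_cos_Ioo hd, ← lintegral_const_mul _ (by fun_prop),
    ← lintegral_indicator measurableSet_Ioo, ← lintegral_indicator hX]
  refine lintegral_congr fun x => ?_
  by_cases hx : x ∈ X
  · by_cases hx' : x ∈ Set.Ioo (c - 2 * d) (c + 2 * d)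
    · rw [Set.indicator_of_mem hx', Set.indicator_of_mem hx, hφ, Set.indicator_of_mem hx,
        Pi.one_apply, one_mul, ← ENNReal.ofReal_ofNat, ← ENNReal.ofReal_mul zero_le_two]
      congr 1
      rw [mul_assoc 2 Real.pi, one_div, one_div, mul_inv 2]
      ring
    -- Outside the support the root of a nonpositive number is 0 and division by it gives 0, so the
    -- density needs no explicit cutoff.
    · rw [Set.indicator_of_notMem hx', Set.indicator_of_mem hx,
        Real.sqrt_eq_zero_of_nonpos, mul_zero, div_zero, ENNReal.ofReal_zero]
      rw [Set.mem_Ioo, not_and_or, not_lt, not_lt] at hx'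
      rcases hx' with h | h <;> nlinarith
  · rw [Set.indicator_of_notMem hx, hφ]
    simp [hx]

theorem lintegral_one_div_sqrt_sub {A B : ℝ} (hB : 0 < B) (hAB : A ≤ B) :
    ∫⁻ u in Set.Ioo (0 : ℝ) 1, ENNReal.ofReal (1 / (Real.pi * √(A - B * u))) =
      ENNReal.ofReal (2 * √A / (Real.pi * B)) := by
  have hπ := Real.pi_pos
  rcases le_or_gt A 0 with hA | hA
  · rw [Real.sqrt_eq_zero_of_nonpos hA, mul_zero, zero_div, ENNReal.ofReal_zero]
    refine setLIntegral_eq_zero measurableSet_Ioo fun u hu => ?_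
    have := mul_pos hB hu.1
    rw [Real.sqrt_eq_zero_of_nonpos (by linarith)]
    simp
  have hr : A / B ≤ 1 := (div_le_one hB).2 hAB
  have hr0 : 0 < A / B := div_pos hA hB
  -- This antiderivative is continuous up to u = A/B, where its derivative blows up; the sign of the
  -- derivative gives integrability. Beyond A/B the integrand is 0 by the convention for roots of
  -- negative numbers.
  have hcont : ContinuousOn (fun u => -(2 / (Real.pi * B)) * √(A - B * u)) (Set.Icc 0 (A / B)) := by
    fun_prop
  have hderiv : ∀ u ∈ Set.Ioo 0 (A / B), HasDerivAt (fun u => -(2 / (Real.pi * B)) * √(A - B * u))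
      (1 / (Real.pi * √(A - B * u))) u := by
    intro u hu
    have hpos : 0 < A - B * u := by
      have := (lt_div_iff₀ hB).1 hu.2
      linarith
    have := (Real.sqrt_pos.2 hpos).ne'
    refine HasDerivAt.congr_deriv (((((hasDerivAt_id' u).const_mul B).const_sub A).sqrt hpos.ne').const_mul
      (-(2 / (Real.pi * B)))) ?_
    field_simp
  have hint : IntervalIntegrable (fun u => 1 / (Real.pi * √(A - B * u))) volume 0 (A / B) := by
    rw [intervalIntegrable_iff_integrableOn_Ioc_of_le hr0.le]
    exact intervalIntegral.integrableOn_deriv_of_nonneg hcont hderiv fun u _ => by positivity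
  have h1 := intervalIntegral.integral_eq_sub_of_hasDerivAt_of_le hr0.le hcont hderiv hint
  rw [mul_div_cancel₀ _ hB.ne', sub_self, Real.sqrt_zero, mul_zero, mul_zero, sub_zero, zero_sub,
    neg_mul, neg_neg, intervalIntegral.integral_of_le hr0.le, integral_Ioc_eq_integral_Ioo] at h1
  have hint' : IntegrableOn (fun u => 1 / (Real.pi * √(A - B * u))) (Set.Ioo 0 (A / B)) :=
    ((intervalIntegrable_iff_integrableOn_Ioo_of_le hr0.le).1 hint)
  have h2 := ofReal_integral_eq_lintegral_ofReal hint' (ae_of_all _ fun u => by positivity)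
  rw [h1] at h2
  rw [show 2 * √A / (Real.pi * B) = 2 / (Real.pi * B) * √A by ring, h2]
  refine setLIntegral_eq_of_subset_of_forall_sdiff_eq_zero measurableSet_Ioo measurableSet_Ioo
    (Set.Ioo_subset_Ioo_right hr) fun u hu => ?_
  have hu' : A / B ≤ u := by
    by_contra hcon
    exact hu.2 ⟨hu.1.1, not_le.1 hcon⟩
  rw [div_le_iff₀ hB] at hu'
  rw [Real.sqrt_eq_zero_of_nonpos (by linarith)]
  simp

/-! ### The mixture of arcsine laws is the Marchenko–Pastur law. -/

section MarchenkoPastur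

variable {β γ : ℝ}

theorem marchenkoPastur_apply (hβ : 0 < β) {X : Set ℝ} (hX : MeasurableSet X) :
    marchenkoPastur β γ X = ∫⁻ x in X, ENNReal.ofReal
      (√((x - β * (1 - √γ) ^ 2) * (β * (1 + √γ) ^ 2 - x)) / (2 * Real.pi * β * x)) := by
  have hle : β * (1 - √γ) ^ 2 ≤ β * (1 + √γ) ^ 2 := by
    have := Real.sqrt_nonneg γ
    gcongr ?_ * ?_
    nlinarith
  rw [marchenkoPastur, withDensity_apply _ hX, Measure.restrict_restrict hX]
  symm
  refine setLIntegral_eq_of_subset_of_forall_sdiff_eq_zero (hX.inter measurableSet_Icc) hX Set.inter_subset_left fun x hx => ?_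
  have hx' : x ∉ Set.Icc (β * (1 - √γ) ^ 2) (β * (1 + √γ) ^ 2) := fun h => hx.2 ⟨hx.1, h⟩
  rw [Set.mem_Icc, not_and_or, not_le, not_le] at hx'
  rw [Real.sqrt_eq_zero_of_nonpos]
  · simp
  · rcases hx' with h | h <;> nlinarith

/-- The u² terms 4β²u² cancel in the difference under the root, leaving D - 4βxu with D =
(x-L₋)(L₊-x). For x > 0 integrating its inverse root gives 2√D/(4πβx); for x < 0 both sides vanish.
-/
theorem lintegral_arcsine_eq_marchenkoPastur_density (hβ : 0 < β) (hγ : 1 ≤ γ) {x : ℝ}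
    (hx : x ≠ 0) :
    ∫⁻ u in Set.Ioo (0 : ℝ) 1, ENNReal.ofReal (1 / (Real.pi *
      √(4 * (β * √((γ - u) * (1 - u))) ^ 2 - (x - β * (γ + 1 - 2 * u)) ^ 2))) =
      ENNReal.ofReal
        (√((x - β * (1 - √γ) ^ 2) * (β * (1 + √γ) ^ 2 - x)) / (2 * Real.pi * β * x)) := by
  have hπ := Real.pi_pos
  have hγ' : √γ ^ 2 = γ := Real.sq_sqrt (by linarith)
  set D := (x - β * (1 - √γ) ^ 2) * (β * (1 + √γ) ^ 2 - x) with hD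
  have hD' : D = 4 * β ^ 2 * γ - (x - β * (γ + 1)) ^ 2 := by
    rw [hD]
    linear_combination (β ^ 2 * (2 - √γ ^ 2 - γ) + 2 * β * x) * hγ'
  have key : ∫⁻ u in Set.Ioo (0 : ℝ) 1, ENNReal.ofReal (1 / (Real.pi *
      √(4 * (β * √((γ - u) * (1 - u))) ^ 2 - (x - β * (γ + 1 - 2 * u)) ^ 2))) =
      ∫⁻ u in Set.Ioo (0 : ℝ) 1, ENNReal.ofReal (1 / (Real.pi * √(D - 4 * β * x * u))) := by
    refine setLIntegral_congr_fun measurableSet_Ioo fun u hu => ?_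
    rw [mul_pow, Real.sq_sqrt (mul_nonneg (by linarith [hu.2]) (by linarith [hu.2])), hD']
    congr 4
    ring
  -- The difference 4βx - D is the square of x - β(γ-1). Hence the zero D/(4βx) of the affine
  -- function does not exceed 1 when x > 0, and D < 0 when x < 0.
  have hDx : D ≤ 4 * β * x := by
    rw [hD']
    nlinarith [sq_nonneg (x - β * (γ - 1))]
  rw [key]
  rcases lt_or_gt_of_ne hx with hx | hx
  · have hD0 : D ≤ 0 := by nlinarith
    rw [Real.sqrt_eq_zero_of_nonpos hD0, zero_div, ENNReal.ofReal_zero]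
    refine setLIntegral_eq_zero measurableSet_Ioo fun u hu => ?_
    rw [Real.sqrt_eq_zero_of_nonpos]
    · simp
    · have := hu.2
      nlinarith [mul_nonneg hβ.le (mul_nonneg (neg_nonneg.2 hx.le) (by linarith : 0 ≤ 1 - u))]
  · rw [lintegral_one_div_sqrt_sub (by positivity) hDx]
    congr 1
    field_simp
    ring

theorem isExpectedSpectralMeasure_laguerreLimitGraph (hβ : 0 < β) (hγ : 1 ≤ γ) :
    IsExpectedSpectralMeasure (volume : Measure unitInterval) (laguerreLimitGraph β γ)
      (marchenkoPastur β γ) := by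
  refine ⟨fun u => (AddCircle.haarAddCircle : Measure UnitAddCircle).map
    (intSymbol (β * (γ + 1 - 2 * u)) (β * √((γ - u) * (1 - u)))), ?_,
    ae_of_all _ fun u => isRootSpectralMeasure_intGraph _ _, fun X hX => ?_⟩
  · refine (Measure.measurable_of_measurable_coe _ fun X hX => ?_).aemeasurable
    have hcont : Continuous fun p : unitInterval × UnitAddCircle =>
        intSymbol (β * (γ + 1 - 2 * p.1)) (β * √((γ - p.1) * (1 - p.1))) p.2 := by
      have h : Continuous fun p : unitInterval × UnitAddCircle =>
          (((β * (γ + 1 - 2 * (p.1 : ℝ)), β * √((γ - p.1) * (1 - p.1))), p.2) :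
            (ℝ × ℝ) × UnitAddCircle) := by fun_prop
      exact continuous_intSymbol.comp h
    simp_rw [Measure.map_apply (measurable_intSymbol _ _) hX]
    exact measurable_measure_prodMk_left (hcont.measurable hX)
  · have h1 : ∀ᵐ u : unitInterval, (AddCircle.haarAddCircle : Measure UnitAddCircle).map
        (intSymbol (β * (γ + 1 - 2 * u)) (β * √((γ - u) * (1 - u)))) X =
        ∫⁻ x in X, ENNReal.ofReal (1 / (Real.pi * √(4 * (β * √((γ - (u : ℝ)) * (1 - u))) ^ 2 -
          (x - β * (γ + 1 - 2 * (u : ℝ))) ^ 2))) := by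
      filter_upwards [ae_unitInterval_mem_Ioo] with u hu
      refine map_intSymbol_apply (mul_pos hβ (Real.sqrt_pos.2 (mul_pos ?_ ?_))) hX
      · linarith [hu.2]
      · linarith [hu.2]
    have h2 := unitInterval.measurePreserving_coe.lintegral_comp_emb
      unitInterval.measurableEmbedding_coe (fun u : ℝ => ∫⁻ x in X, ENNReal.ofReal (1 /
        (Real.pi * √(4 * (β * √((γ - u) * (1 - u))) ^ 2 - (x - β * (γ + 1 - 2 * u)) ^ 2))))
    -- Tonelli: for each x the density is averaged over u before integrating over `X`.
    rw [lintegral_congr_ae h1, h2, ← setLIntegral_congr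
      (Ioo_ae_eq_Icc (μ := (volume : Measure ℝ)) (a := 0) (b := 1)),
      lintegral_lintegral_swap (by fun_prop), marchenkoPastur_apply hβ hX]
    refine lintegral_congr_ae (ae_restrict_of_ae ?_)
    have h0 : ∀ᵐ x : ℝ, x ≠ 0 := compl_mem_ae_iff.2 (measure_singleton _)
    filter_upwards [h0] with x hx
    exact (lintegral_arcsine_eq_marchenkoPastur_density hβ hγ hx).symm

end MarchenkoPastur

theorem theorem2 (β γ : ℝ) (hβ : 0 < β) (hγ : 1 ≤ γ)
    {Ω : Type*} [MeasurableSpace Ω] (P : Measure Ω) [IsProbabilityMeasure P]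
    (a b : ℕ → ℕ → Ω → ℝ)
    (hL : ∀ n, 1 ≤ n → IsLaguerreEntries β γ n P (a n) (b n)) :
    -- convergence for almost every realization of the matrices, only the root being random
    (∀ᵐ ω ∂P, BenjaminiSchrammConverges uniformRoot
      (fun n o => tridiagGraph n (fun j => a (n + 1) j ω) (fun j => b (n + 1) j ω) o)
      (volume : Measure unitInterval) (laguerreLimitGraph β γ)) ∧
    -- convergence when both the matrix and the (independent) root are random
    BenjaminiSchrammConverges (fun n => P.prod (uniformRoot n))
      (fun n p => tridiagGraph n (fun j => a (n + 1) j p.1) (fun j => b (n + 1) j p.1) p.2)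
      (volume : Measure unitInterval) (laguerreLimitGraph β γ) ∧
    -- the expected spectral measure of the limit is the Marchenko–Pastur law
    IsExpectedSpectralMeasure (volume : Measure unitInterval) (laguerreLimitGraph β γ)
      (marchenkoPastur β γ) :=
  ⟨ae_benjaminiSchrammConverges_laguerre hβ hγ hL, benjaminiSchrammConverges_laguerre hβ hγ hL,
    isExpectedSpectralMeasure_laguerreLimitGraph hβ hγ⟩
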